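/- Let $d \ge 2$ be an integer and let $T_d^{\mathrm{root}}$ be the regular rooted tree of branching degree $d$, i.e. the infinite tree with a root $v_0$ in which every vertex at distance $r$ from $v_0$ has exactly $d$ neighbours at distance $r+1$ from $v_0$, for every $r \ge 0$; let $V$ be its vertex set. Let $A$ be its adjacency operator on the complex Hilbert space $\ell^2(V)$, defined by $(A\xi)(u) = \sum_{v \sim u} \xi(v)$. For a bounded self-adjoint operator $X$ on a Hilbert space $\mathcal H$ and $\xi \in \mathcal H$, let $\mu_\xi$ denote the local spectral measure of $X$ at $\xi$, i.e. the finite Borel measure on $\mathbf R$ (carried by the spectrum of $X$) with $\int f \, d\mu_\xi = \langle f(X)\xi \mid \xi\rangle$ for all continuous functions $f$; equivalently $\mu_\xi(B) = \langle E_X(B)\xi \mid \xi \rangle$, where $E_X$ is the projection-valued spectral measure of $X$. A scalar-valued spectral measure for $X$ is a measure of the form $\mu_\xi$ where $\xi$ is such that $\mu_\eta$ is absolutely continuous with respect to $\mu_\xi$ for all $\eta \in \mathcal H$. For $n \in \{1, 2, \dots, \infty\}$, the operator $X$ has uniform multiplicity $n$ if it is unitarily equivalent to multiplication by the coordinate $x$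 on the space $L^2(\Sigma, \mu, \mathfrak m)$ for a scalar-valued spectral measure $\mu$ for $X$ on its spectrum $\Sigma$ and a measurable function $\mathfrak m : \Sigma \to \{1, 2, \dots, \infty\}$ with $\mathfrak m = n$ $\mu$-almost everywhere. Here $L^2(\Sigma, \mu, \mathfrak m)$ consists of the square-integrable functions $\xi$ from $\Sigma$ to the space of square-summable complex sequences $(z_j)_{j \ge 1}$ such that the terms of $\xi(x)$ of index $j > \mathfrak m(x)$ vanish. Then: 1. The norm of $A$ is $2\sqrt d$. 2. The spectrum of $A$ is $[-2\sqrt d, 2\sqrt d]$. 3. The local spectral measure of $A$ at $\delta_{v_0}$ is $$d\mu(x) = \frac{1}{2\pi d}\sqrt{4d - x^2}\, dx \qquad \text{on } [-2\sqrt d, 2\sqrt d],$$ where $dx$ is Lebesgue measure, and $\mu$ is a scalar-valued spectral measure for $A$. 4. $A$ has infinite uniform multiplicity. -/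

import Mathlib

open MeasureTheory

/-! ### Adjacency operators -/

/-- The complex Hilbert space `ℓ²(V)`. -/
abbrev EllTwo (V : Type*) : Type _ := lp (fun _ : V => ℂ) 2

section Adjacency

variable {V : Type*} (G : SimpleGraph V) [G.LocallyFinite]

theorem adjacency_sum_le {D : ℕ} (hD : ∀ u, G.degree u ≤ D) (ξ : EllTwo V) (s : Finset V) :
    ∑ u ∈ s, ‖∑ v ∈ G.neighborFinset u, ξ v‖ ^ (2 : ENNReal).toReal
      ≤ ((D : ℝ) * ‖ξ‖) ^ (2 : ENNReal).toReal := by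
  classical
  have h2 : (0 : ℝ) < (2 : ENNReal).toReal := by norm_num
  have hxi : ∀ t : Finset V, ∑ v ∈ t, ‖ξ v‖ ^ 2 ≤ ‖ξ‖ ^ 2 := by
    intro t
    have := lp.sum_rpow_le_norm_rpow h2 ξ t
    simpa using this
  have h1 : ∀ u, ‖∑ v ∈ G.neighborFinset u, ξ v‖ ^ 2
      ≤ (D : ℝ) * ∑ v ∈ G.neighborFinset u, ‖ξ v‖ ^ 2 := by
    intro u
    have hc : ((G.neighborFinset u).card : ℝ) ≤ D := by
      exact_mod_cast hD u
    calc ‖∑ v ∈ G.neighborFinset u, ξ v‖ ^ 2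
        ≤ (∑ v ∈ G.neighborFinset u, ‖ξ v‖) ^ 2 := by
          gcongr
          exact norm_sum_le _ _
      _ ≤ (G.neighborFinset u).card * ∑ v ∈ G.neighborFinset u, ‖ξ v‖ ^ 2 :=
          sq_sum_le_card_mul_sum_sq
      _ ≤ (D : ℝ) * ∑ v ∈ G.neighborFinset u, ‖ξ v‖ ^ 2 := by
          gcongr
  have h3 : ∑ u ∈ s, ∑ v ∈ G.neighborFinset u, ‖ξ v‖ ^ 2
      = ∑ v ∈ s.biUnion (fun u => G.neighborFinset u),
          ∑ _u ∈ s.filter (fun u => u ∈ G.neighborFinset v), ‖ξ v‖ ^ 2 := by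
    apply Finset.sum_comm'
    intro u v
    simp only [Finset.mem_biUnion, Finset.mem_filter, SimpleGraph.mem_neighborFinset]
    constructor
    · rintro ⟨hu, huv⟩
      exact ⟨⟨hu, huv.symm⟩, u, hu, huv⟩
    · rintro ⟨⟨hu, hvu⟩, -⟩
      exact ⟨hu, hvu.symm⟩
  have h4 : ∑ u ∈ s, ∑ v ∈ G.neighborFinset u, ‖ξ v‖ ^ 2 ≤ (D : ℝ) * ‖ξ‖ ^ 2 := by
    rw [h3]
    calc _ ≤ ∑ v ∈ s.biUnion (fun u => G.neighborFinset u), (D : ℝ) * ‖ξ v‖ ^ 2 := by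
          apply Finset.sum_le_sum
          intro v _
          rw [Finset.sum_const, nsmul_eq_mul]
          gcongr
          refine le_trans (Finset.card_le_card ?_) (hD v)
          intro u hu
          exact (Finset.mem_filter.mp hu).2
      _ ≤ (D : ℝ) * ‖ξ‖ ^ 2 := by
          rw [← Finset.mul_sum]
          gcongr
          exact hxi _
  have h5 : ∑ u ∈ s, ‖∑ v ∈ G.neighborFinset u, ξ v‖ ^ 2 ≤ ((D : ℝ) * ‖ξ‖) ^ 2 := by
    calc _ ≤ ∑ u ∈ s, (D : ℝ) * ∑ v ∈ G.neighborFinset u, ‖ξ v‖ ^ 2 :=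
          Finset.sum_le_sum fun u _ => h1 u
      _ = (D : ℝ) * ∑ u ∈ s, ∑ v ∈ G.neighborFinset u, ‖ξ v‖ ^ 2 := by rw [Finset.mul_sum]
      _ ≤ (D : ℝ) * ((D : ℝ) * ‖ξ‖ ^ 2) := by gcongr
      _ = _ := by ring
  simpa using h5

/-- The adjacency operator of a graph of bounded degree: the bounded operator on `ℓ²(V)` with
`(A ξ)(u) = ∑ ξ(v)`, the sum being over the neighbours `v` of `u`. -/
noncomputable def adjacencyOperator (hG : ∃ D : ℕ, ∀ u, G.degree u ≤ D) :
    EllTwo V →L[ℂ] EllTwo V :=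
  LinearMap.mkContinuousOfExistsBound
    { toFun := fun ξ => ⟨fun u => ∑ v ∈ G.neighborFinset u, ξ v,
        memℓp_gen' (adjacency_sum_le G hG.choose_spec ξ)⟩
      map_add' := fun ξ η => by
        ext u
        exact Finset.sum_add_distrib
      map_smul' := fun c ξ => by
        ext u
        simp [Finset.mul_sum] }
    ⟨hG.choose, fun ξ => lp.norm_le_of_forall_sum_le (by norm_num) (by positivity)
      (adjacency_sum_le G hG.choose_spec ξ)⟩

end Adjacency

/-! ### The regular rooted tree -/

/-- The regular rooted tree of branching degree `d`. Its vertices are the finite words in an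
alphabet of `d` letters, the root is the empty word, and the `d` children of a word `w` are the
words `i :: w`. -/
def regularRootedTree (d : ℕ) : SimpleGraph (List (Fin d)) where
  Adj v w := (∃ i, w = i :: v) ∨ (∃ i, v = i :: w)
  symm := ⟨fun _ _ h => h.symm⟩
  loopless := ⟨fun v h => by
    rcases h with ⟨i, h⟩ | ⟨i, h⟩ <;> exact absurd (congrArg List.length h) (by simp)⟩

theorem regularRootedTree_neighborSet_subset (d : ℕ) (v : List (Fin d)) :
    (regularRootedTree d).neighborSet v ⊆
      ((Finset.univ.image (fun i : Fin d => i :: v)) ∪ {v.tail} : Finset (List (Fin d))) := by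
  intro w hw
  rcases hw with ⟨i, rfl⟩ | ⟨i, rfl⟩ <;> simp

noncomputable instance regularRootedTree_locallyFinite (d : ℕ) :
    (regularRootedTree d).LocallyFinite := fun v =>
  ((Finset.finite_toSet _).subset (regularRootedTree_neighborSet_subset d v)).fintype

theorem regularRootedTree_boundedDegree (d : ℕ) :
    ∃ D : ℕ, ∀ u, (regularRootedTree d).degree u ≤ D := by
  refine ⟨d + 1, fun u => ?_⟩
  rw [← SimpleGraph.card_neighborFinset_eq_degree]
  refine (Finset.card_le_card (t := (Finset.univ.image (fun i : Fin d => i :: u)) ∪ {u.tail})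
    fun w hw => ?_).trans ((Finset.card_union_le _ _).trans ?_)
  · exact regularRootedTree_neighborSet_subset d u ((SimpleGraph.mem_neighborFinset _ _ _).mp hw)
  · simpa using Finset.card_image_le (s := (Finset.univ : Finset (Fin d))) (f := fun i => i :: u)

/-- The adjacency operator of the regular rooted tree of branching degree `d`. -/
noncomputable def rootedTreeOperator (d : ℕ) :
    EllTwo (List (Fin d)) →L[ℂ] EllTwo (List (Fin d)) :=
  adjacencyOperator (regularRootedTree d) (regularRootedTree_boundedDegree d)

/-! ### Local spectral measures, dominant vectors, scalar-valued spectral measures -/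

section Spectral

variable {H : Type*} [NormedAddCommGroup H] [InnerProductSpace ℂ H] [CompleteSpace H]

open scoped CompactlySupported

/-- The positive linear functional `f ↦ ⟨f(X) ξ | ξ⟩`, where `f(X)` is given by the continuous
functional calculus of the self-adjoint operator `X`. -/
noncomputable def spectralFunctional (X : H →L[ℂ] H) (ξ : H) : C_c(ℝ, ℝ) →ₚ[ℝ] ℝ :=
  PositiveLinearMap.mk₀
    { toFun := fun f => (inner ℂ ξ (cfc (fun x => f x) X ξ)).re
      map_add' := fun f g => by
        have := cfc_add (a := X) (fun x => f x) (fun x => g x)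
          f.continuous.continuousOn g.continuous.continuousOn
        simp only [CompactlySupportedContinuousMap.coe_add, Pi.add_apply, this]
        simp
      map_smul' := fun c f => by
        have := cfc_smul (a := X) c (fun x => f x) f.continuous.continuousOn
        simp only [CompactlySupportedContinuousMap.coe_smul, Pi.smul_apply, this]
        simp }
    (fun f hf => by
      have h : (0 : H →L[ℂ] H) ≤ cfc (fun x => f x) X := cfc_nonneg fun x _ => hf x
      have h' := (ContinuousLinearMap.nonneg_iff_isPositive _).mp h
      exact h'.re_inner_nonneg_right ξ)

/-- The local spectral measure `μ_ξ` of a self-adjoint operator `X` at a vector `ξ`, seen as a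
measure on `ℝ`: the measure with `∫ f dμ_ξ = ⟨f(X) ξ | ξ⟩` for all compactly supported
continuous `f`, provided by the Riesz–Markov–Kakutani theorem. In terms of the projection-valued
spectral measure `E` of `X`, it is `μ_ξ(B) = ⟨E(B) ξ | ξ⟩`. -/
noncomputable def localSpectralMeasure (X : H →L[ℂ] H) (ξ : H) : Measure ℝ :=
  RealRMK.rieszMeasure (spectralFunctional X ξ)

theorem integral_localSpectralMeasure (X : H →L[ℂ] H) (ξ : H) (f : C_c(ℝ, ℝ)) :
    ∫ x, f x ∂(localSpectralMeasure X ξ) = (inner ℂ ξ (cfc (fun x => f x) X ξ)).re :=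
  RealRMK.integral_rieszMeasure (spectralFunctional X ξ) f

/-- A vector `ξ` is dominant for `X` if all local spectral measures of `X` are absolutely
continuous with respect to the one at `ξ`. -/
def IsDominantVector (X : H →L[ℂ] H) (ξ : H) : Prop :=
  ∀ η : H, localSpectralMeasure X η ≪ localSpectralMeasure X ξ

/-- A scalar-valued spectral measure for `X` is a measure of the form `μ_ξ` with `ξ` dominant. -/
def IsScalarSpectralMeasure (X : H →L[ℂ] H) (μ : Measure ℝ) : Prop :=
  ∃ ξ : H, IsDominantVector X ξ ∧ μ = localSpectralMeasure X ξ

end Spectral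

/-! ### Straight multiplication operators and spectral multiplicity -/

section Multiplicity

variable {S : Set ℝ}

/-- The Hilbert space `L²(S, μ, m)`: square-integrable functions `ξ` from `S` to the space of
square-summable sequences, such that `ξ(x)` belongs to the subspace of sequences supported on
the first `m(x)` indices. -/
noncomputable def multiplicityL2 (μ : Measure S) (m : S → ℕ∞) :
    Submodule ℂ (Lp (EllTwo ℕ) 2 μ) where
  carrier := {ξ | ∀ᵐ x ∂μ, ∀ j : ℕ, m x ≤ (j : ℕ∞) → ξ x j = 0}
  add_mem' := fun {ξ η} hξ hη => by
    filter_upwards [hξ, hη, Lp.coeFn_add ξ η] with x h1 h2 h3 j hj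
    rw [h3, Pi.add_apply, lp.coeFn_add, Pi.add_apply, h1 j hj, h2 j hj, add_zero]
  zero_mem' := by
    filter_upwards [Lp.coeFn_zero (EllTwo ℕ) 2 μ] with x h j _
    rw [h]
    rfl
  smul_mem' := fun c ξ hξ => by
    filter_upwards [hξ, Lp.coeFn_smul c ξ] with x h1 h2 j hj
    rw [h2, Pi.smul_apply, lp.coeFn_smul, Pi.smul_apply, h1 j hj, smul_zero]

theorem exists_norm_le_of_isCompact (hS : IsCompact S) : ∃ C : ℝ, ∀ x : S, ‖(x : ℝ)‖ ≤ C := by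
  obtain ⟨C, hC⟩ := hS.isBounded.exists_norm_le
  exact ⟨C, fun x => hC x x.2⟩

theorem memLp_id_smul (hS : IsCompact S) {μ : Measure S} (ξ : Lp (EllTwo ℕ) 2 μ) :
    MemLp (fun x : S => ((x : ℝ) : ℂ) • ξ x) 2 μ := by
  obtain ⟨C, hC⟩ := exists_norm_le_of_isCompact hS
  refine (Lp.memLp ξ).of_le_mul (c := C) ?_ (Filter.Eventually.of_forall fun x => ?_)
  · exact ((by fun_prop : Measurable fun x : S => ((x : ℝ) : ℂ)).aestronglyMeasurable).smul
      (Lp.aestronglyMeasurable ξ)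
  · rw [norm_smul, Complex.norm_real]
    exact mul_le_mul_of_nonneg_right (hC x) (norm_nonneg _)

/-- Multiplication by the coordinate `x` on square-integrable sequence-valued functions on a
compact subset of the line. -/
noncomputable def coordinateMul (hS : IsCompact S) (μ : Measure S) :
    Lp (EllTwo ℕ) 2 μ →L[ℂ] Lp (EllTwo ℕ) 2 μ :=
  LinearMap.mkContinuousOfExistsBound
    { toFun := fun ξ => (memLp_id_smul hS ξ).toLp _
      map_add' := fun ξ η => by
        ext1
        filter_upwards [(memLp_id_smul hS (ξ + η)).coeFn_toLp, (memLp_id_smul hS ξ).coeFn_toLp,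
          (memLp_id_smul hS η).coeFn_toLp, Lp.coeFn_add ξ η,
          Lp.coeFn_add ((memLp_id_smul hS ξ).toLp _) ((memLp_id_smul hS η).toLp _)]
          with x h1 h2 h3 h4 h5
        rw [h1, h5, Pi.add_apply, h2, h3, h4, Pi.add_apply, smul_add]
      map_smul' := fun c ξ => by
        ext1
        filter_upwards [(memLp_id_smul hS (c • ξ)).coeFn_toLp, (memLp_id_smul hS ξ).coeFn_toLp,
          Lp.coeFn_smul c ξ, Lp.coeFn_smul c ((memLp_id_smul hS ξ).toLp _)] with x h1 h2 h3 h4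
        rw [h1, RingHom.id_apply, h4, Pi.smul_apply, h2, h3, Pi.smul_apply, smul_comm] }
    ((exists_norm_le_of_isCompact hS).imp fun C hC ξ => by
      refine Lp.norm_le_mul_norm_of_ae_le_mul ?_
      filter_upwards [(memLp_id_smul hS ξ).coeFn_toLp] with x hx
      refine (congrArg norm hx).trans_le ?_
      rw [norm_smul, Complex.norm_real]
      exact mul_le_mul_of_nonneg_right (hC x) (norm_nonneg _))

theorem coordinateMul_mem (hS : IsCompact S) (μ : Measure S) (m : S → ℕ∞)
    (ξ : Lp (EllTwo ℕ) 2 μ) (hξ : ξ ∈ multiplicityL2 μ m) :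
    coordinateMul hS μ ξ ∈ multiplicityL2 μ m := by
  change ∀ᵐ x ∂μ, ∀ j : ℕ, m x ≤ (j : ℕ∞) → ξ x j = 0 at hξ
  change ∀ᵐ x ∂μ, ∀ j : ℕ, m x ≤ (j : ℕ∞) → ((memLp_id_smul hS ξ).toLp _ : S → EllTwo ℕ) x j = 0
  filter_upwards [hξ, (memLp_id_smul hS ξ).coeFn_toLp] with x h1 h2 j hj
  rw [h2, lp.coeFn_smul, Pi.smul_apply, h1 j hj, smul_zero]

/-- The straight multiplication operator `M_{S, μ, m}` on `L²(S, μ, m)`: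
`(M ξ)(x) = x ξ(x)`. -/
noncomputable def straightMul (hS : IsCompact S) (μ : Measure S) (m : S → ℕ∞) :
    multiplicityL2 μ m →L[ℂ] multiplicityL2 μ m :=
  ((coordinateMul hS μ).comp (multiplicityL2 μ m).subtypeL).codRestrict (multiplicityL2 μ m)
    fun ξ => coordinateMul_mem hS μ m ξ ξ.2

/-- Two operators are unitarily equivalent if some surjective linear isometry intertwines them. -/
def UnitarilyEquivalent {H₁ H₂ : Type*} [NormedAddCommGroup H₁] [NormedSpace ℂ H₁]
    [NormedAddCommGroup H₂] [NormedSpace ℂ H₂] (X₁ : H₁ →L[ℂ] H₁) (X₂ : H₂ →L[ℂ] H₂) : Prop :=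
  ∃ U : H₁ ≃ₗᵢ[ℂ] H₂, ∀ ξ, U (X₁ ξ) = X₂ (U ξ)

variable {H : Type*} [NormedAddCommGroup H] [InnerProductSpace ℂ H] [CompleteSpace H]

/-- `m` is a spectral multiplicity function of the self-adjoint operator `X`, relative to the
scalar-valued spectral measure `μ` of `X`: it is a measurable function from the spectrum of `X`
to `{1, 2, …, ∞}`, and `X` is unitarily equivalent to the straight multiplication operator
`M_{Σ, μ, m}`, where `Σ` is the spectrum of `X`. -/
structure IsSpectralMultiplicity (X : H →L[ℂ] H) (μ : Measure ℝ) (m : spectrum ℝ X → ℕ∞) :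
    Prop where
  scalar : IsScalarSpectralMeasure X μ
  measurable : Measurable m
  one_le : ∀ x, 1 ≤ m x
  unitary : UnitarilyEquivalent X
    (straightMul (spectrum.isCompact (𝕜 := ℝ) X) (μ.comap Subtype.val) m)

/-- `X` is of uniform multiplicity `n ∈ {1, 2, …, ∞}` if its spectral multiplicity function is
equal to `n` almost everywhere. -/
def HasUniformMultiplicity (X : H →L[ℂ] H) (n : ℕ∞) : Prop :=
  ∃ (μ : Measure ℝ) (m : spectrum ℝ X → ℕ∞),
    IsSpectralMultiplicity X μ m ∧ ∀ᵐ x ∂(μ.comap (Subtype.val : spectrum ℝ X → ℝ)), m x = n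

end Multiplicity

/-! Moving a function one level away from the root and dividing by `√d` is an isometry `S` of
`ℓ²(V)`, and `A = √d (S + S†)` (`rootedTreeOperator_eq`). Everything else is about such an operator.
The shift is pure: a vector in the range of every power of `S` vanishes at every vertex. So if `b j`
is an orthonormal basis of the wandering subspace `ker S†`, the vectors `S^n (b j)` form a Hilbert
basis of the whole space (`exists_tree_hilbertBasis`). Since `d ≥ 2`, differences of sibling delta
functions make `ker S†` infinite-dimensional. For each unit vector `b` in `ker S†`, the operator `A`
acts on the orthonormal sequence `S^n b` as the Jacobi matrix with zero diagonal and off-diagonal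
entries `√d`. This is the recurrence of the Chebyshev polynomials of the second kind rescaled to
`[-2√d, 2√d]`, whence `S^n b = U_n(A) b` (`aeval_scaledU_apply`). Hence the moments of `A` at `b`
are those of the semicircle law, and Weierstrass approximation identifies the local spectral measure
(`localSpectralMeasure_jacobi`). The vector at the root is one such `b`. The norm is at most `2√d`
because `S` is an isometry; the spectrum fills the interval because the density is positive inside
it. Finally `S^n (b j) ↦ U_n ⊗ e_j` is a unitary onto `L²(μ; ℓ²)` carrying `A` to multiplication by
`x` (`exists_isometryEquiv_coordinateMul`). This gives infinite multiplicity, and it shows that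
every local spectral measure has a density with respect to `μ`. -/

/-! ### The shift isometry of the rooted tree -/

/-- Pushing a function on words one level up the tree, and dividing it by `√d`. -/
noncomputable def treeShiftFun (d : ℕ) (ξ : List (Fin d) → ℂ) : List (Fin d) → ℂ
  | [] => 0
  | _ :: w => ξ w / (√(d : ℝ) : ℝ)

/-- Each value is copied to `d` children with squared modulus divided by `d`, and the root
contributes nothing. Nonempty words are indexed by pairs (parent, letter). -/
theorem hasSum_treeShiftFun (d : ℕ) [NeZero d] (ξ : EllTwo (List (Fin d))) :
    HasSum (fun u => ‖treeShiftFun d ξ u‖ ^ (2 : ENNReal).toReal)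
      (‖ξ‖ ^ (2 : ENNReal).toReal) := by
  have hd : (0 : ℝ) < d := by exact_mod_cast Nat.pos_of_ne_zero (NeZero.ne d)
  have hinj : Function.Injective (fun p : List (Fin d) × Fin d => p.2 :: p.1) := by
    rintro ⟨a, b⟩ ⟨a', b'⟩ h
    simp only [List.cons.injEq] at h
    exact Prod.ext h.2 h.1
  rw [← hinj.hasSum_iff]
  · have h := lp.hasSum_norm (p := 2) (by norm_num) ξ
    have hs : Summable fun p : List (Fin d) × Fin d =>
        ‖ξ p.1‖ ^ (2 : ENNReal).toReal / d := by
      refine (summable_prod_of_nonneg (fun p => by positivity)).2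
        ⟨fun w => Summable.of_finite, ?_⟩
      simpa [tsum_fintype, mul_div_cancel₀ _ hd.ne'] using h.summable
    have h2 := hs.hasSum
    rw [hs.tsum_prod' fun _ => Summable.of_finite] at h2
    have h3 : ∑' w, ∑' _ : Fin d, ‖ξ w‖ ^ (2 : ENNReal).toReal / d
        = ‖ξ‖ ^ (2 : ENNReal).toReal := by
      rw [← h.tsum_eq]
      congr 1
      ext w
      rw [tsum_fintype, Finset.sum_const, Finset.card_univ, Fintype.card_fin, nsmul_eq_mul,
        mul_div_cancel₀ _ hd.ne']
    rw [h3] at h2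
    refine h2.congr_fun fun p => ?_
    simp [treeShiftFun, div_pow, Real.sq_sqrt hd.le]
  · rintro u hu
    cases u with
    | nil => simp [treeShiftFun]
    | cons i w => exact absurd ⟨(w, i), rfl⟩ hu

/-- The shift isometry of the regular rooted tree. -/
noncomputable def treeShift (d : ℕ) [NeZero d] :
    EllTwo (List (Fin d)) →ₗᵢ[ℂ] EllTwo (List (Fin d)) where
  toFun ξ := ⟨treeShiftFun d ξ, memℓp_gen (hasSum_treeShiftFun d ξ).summable⟩
  map_add' ξ η := by
    ext u
    cases u with
    | nil => exact (add_zero 0).symm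
    | cons i w => exact add_div _ _ _
  map_smul' c ξ := by
    ext u
    cases u with
    | nil => exact (mul_zero c).symm
    | cons i w => exact mul_div_assoc _ _ _
  norm_map' ξ := by
    have h := lp.norm_rpow_eq_tsum (p := 2) (by norm_num)
      (⟨treeShiftFun d ξ, memℓp_gen (hasSum_treeShiftFun d ξ).summable⟩ : EllTwo (List (Fin d)))
    have h' := h.trans (hasSum_treeShiftFun d ξ).tsum_eq
    exact (Real.rpow_left_inj (norm_nonneg _) (norm_nonneg _) (by norm_num)).1 h'

theorem treeShift_nil (d : ℕ) [NeZero d] (ξ : EllTwo (List (Fin d))) : treeShift d ξ [] = 0 := rfl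

theorem treeShift_cons (d : ℕ) [NeZero d] (ξ : EllTwo (List (Fin d))) (i : Fin d)
    (w : List (Fin d)) : treeShift d ξ (i :: w) = ξ w / (√(d : ℝ) : ℝ) := rfl

/-- This is purity of the shift: it excludes a unitary summand in the Wold decomposition. -/
theorem treeShift_iterate_apply (d : ℕ) [NeZero d] (n : ℕ) (ξ : EllTwo (List (Fin d)))
    (u : List (Fin d)) (hu : u.length < n) : ((treeShift d)^[n] ξ) u = 0 := by
  induction n generalizing u with
  | zero => simp at hu
  | succ n ih =>
    rw [Function.iterate_succ_apply']
    cases u with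
    | nil => rfl
    | cons i w =>
      rw [treeShift_cons, ih w (by simpa using hu), zero_div]

theorem treeShift_single (d : ℕ) [NeZero d] (w : List (Fin d)) :
    treeShift d (lp.single 2 w (1 : ℂ)) =
      ∑ i : Fin d, (((√(d : ℝ) : ℝ) : ℂ)⁻¹) • lp.single 2 (i :: w) (1 : ℂ) := by
  ext u
  rw [lp.coeFn_sum, Finset.sum_apply]
  cases u with
  | nil => simp [treeShift_nil, lp.single_apply]
  | cons i v =>
    rw [treeShift_cons]
    by_cases h : v = w
    · subst h
      simp [lp.single_apply, Pi.single_apply]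
    · simp [lp.single_apply, h]

theorem adjoint_treeShift_apply (d : ℕ) [NeZero d] (ξ : EllTwo (List (Fin d)))
    (w : List (Fin d)) :
    ((treeShift d).toContinuousLinearMap.adjoint ξ) w =
      (∑ i : Fin d, ξ (i :: w)) / (√(d : ℝ) : ℝ) := by
  have h1 : ((treeShift d).toContinuousLinearMap.adjoint ξ) w
      = inner ℂ (lp.single 2 w (1 : ℂ)) ((treeShift d).toContinuousLinearMap.adjoint ξ) := by
    rw [lp.inner_single_left]; simp
  rw [h1, ContinuousLinearMap.adjoint_inner_right]
  change inner ℂ (treeShift d (lp.single 2 w (1 : ℂ))) ξ = _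
  rw [treeShift_single, sum_inner, Finset.sum_div]
  refine Finset.sum_congr rfl fun i _ => ?_
  rw [inner_smul_left, lp.inner_single_left]
  simp [div_eq_inv_mul]

theorem regularRootedTree_sum_neighborFinset (d : ℕ) (u : List (Fin d))
    (f : List (Fin d) → ℂ) :
    ∑ v ∈ (regularRootedTree d).neighborFinset u, f v
      = (∑ i : Fin d, f (i :: u)) + (match u with | [] => 0 | _ :: w => f w) := by
  have hinj : Set.InjOn (fun i : Fin d => i :: u) (Finset.univ : Finset (Fin d)) := by
    intro i _ j _ h
    simpa using h
  cases u with
  | nil =>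
    have h : (regularRootedTree d).neighborFinset [] = Finset.univ.image fun i : Fin d => [i] := by
      ext v
      rw [SimpleGraph.mem_neighborFinset]
      simp [regularRootedTree, eq_comm]
    rw [h, Finset.sum_image hinj]
    simp
  | cons j w =>
    have h : (regularRootedTree d).neighborFinset (j :: w) =
        insert w (Finset.univ.image fun i : Fin d => i :: j :: w) := by
      ext v
      rw [SimpleGraph.mem_neighborFinset]
      simp [regularRootedTree, eq_comm, or_comm]
    have hw : w ∉ Finset.univ.image fun i : Fin d => i :: j :: w := by
      simp only [Finset.mem_image, Finset.mem_univ, true_and, not_exists]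
      intro i hi
      have := congrArg List.length hi
      simp only [List.length_cons] at this
      omega
    rw [h, Finset.sum_insert hw, Finset.sum_image hinj, add_comm]

theorem rootedTreeOperator_apply (d : ℕ) (ξ : EllTwo (List (Fin d))) (u : List (Fin d)) :
    rootedTreeOperator d ξ u = ∑ v ∈ (regularRootedTree d).neighborFinset u, ξ v := rfl

/-- The sum over the children is `√d S†` and the value at the parent is `√d S`. -/
theorem rootedTreeOperator_eq (d : ℕ) [NeZero d] :
    rootedTreeOperator d = ((√(d : ℝ) : ℝ) : ℂ) • ((treeShift d).toContinuousLinearMap +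
      (treeShift d).toContinuousLinearMap.adjoint) := by
  have hd : ((√(d : ℝ) : ℝ) : ℂ) ≠ 0 := by
    simp [NeZero.ne d]
  have hdd : ((√(d : ℝ) : ℝ) : ℂ) * ((√(d : ℝ) : ℝ) : ℂ) = d := by
    rw [← Complex.ofReal_mul, Real.mul_self_sqrt (by positivity)]
    simp
  ext ξ u
  rw [rootedTreeOperator_apply, regularRootedTree_sum_neighborFinset]
  simp only [smul_apply, add_apply, lp.coeFn_smul,
    lp.coeFn_add, Pi.smul_apply, Pi.add_apply, adjoint_treeShift_apply, smul_eq_mul, mul_add,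
    mul_div_cancel₀ _ hd]
  rw [add_comm]
  congr 1
  cases u with
  | nil => exact (mul_zero _).symm
  | cons i w =>
    change ξ w = _ * (ξ w / _)
    rw [mul_div_cancel₀ _ hd]

theorem adjoint_treeShift_single_nil (d : ℕ) [NeZero d] :
    (treeShift d).toContinuousLinearMap.adjoint (lp.single 2 [] (1 : ℂ)) = 0 := by
  ext w
  rw [adjoint_treeShift_apply]
  simp [lp.single_apply]

/-- The adjoint only sees sums over siblings, so differences of siblings are wandering vectors. -/
theorem adjoint_treeShift_single_sub (d : ℕ) [NeZero d] (i j : Fin d) (w : List (Fin d)) :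
    (treeShift d).toContinuousLinearMap.adjoint
      (lp.single 2 (i :: w) (1 : ℂ) - lp.single 2 (j :: w) (1 : ℂ)) = 0 := by
  ext v
  rw [adjoint_treeShift_apply]
  by_cases h : v = w
  · subst h
    simp [lp.single_apply, Pi.single_apply]
  · simp [lp.single_apply, h]

/-! ### Wandering vectors of an isometry -/

theorem inner_isometry_iterate_self {H : Type*} [NormedAddCommGroup H] [InnerProductSpace ℂ H]
    (S : H →ₗᵢ[ℂ] H) (b b' : H) (n : ℕ) :
    inner ℂ (S^[n] b) (S^[n] b') = inner ℂ b b' := by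
  induction n with
  | zero => rfl
  | succ n ih => rw [Function.iterate_succ_apply', Function.iterate_succ_apply',
      S.inner_map_map, ih]

section Wold

variable {H : Type*} [NormedAddCommGroup H] [InnerProductSpace ℂ H] [CompleteSpace H]

theorem adjoint_apply_isometry (S : H →ₗᵢ[ℂ] H) (ξ : H) :
    S.toContinuousLinearMap.adjoint (S ξ) = ξ := by
  refine ext_inner_left ℂ fun η => ?_
  rw [ContinuousLinearMap.adjoint_inner_right]
  exact S.inner_map_map η ξ

/-- Cancelling the common power `S^n` leaves at least one `S` on the right, which moves to `b` as
`S†`. -/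
theorem inner_isometry_iterate_of_lt (S : H →ₗᵢ[ℂ] H) {b : H}
    (hb : S.toContinuousLinearMap.adjoint b = 0) (b' : H) {n m : ℕ} (hnm : n < m) :
    inner ℂ (S^[n] b) (S^[m] b') = 0 := by
  induction n generalizing m with
  | zero =>
    obtain ⟨m, rfl⟩ := Nat.exists_eq_succ_of_ne_zero hnm.ne'
    rw [Function.iterate_succ_apply', Function.iterate_zero_apply]
    change inner ℂ b (S.toContinuousLinearMap _) = 0
    rw [← ContinuousLinearMap.adjoint_inner_left, hb, inner_zero_left]
  | succ n ih =>
    obtain ⟨m, rfl⟩ := Nat.exists_eq_succ_of_ne_zero (Nat.ne_zero_of_lt hnm)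
    rw [Function.iterate_succ_apply', Function.iterate_succ_apply', S.inner_map_map]
    exact ih (Nat.lt_of_succ_lt_succ hnm)

theorem inner_isometry_iterate (S : H →ₗᵢ[ℂ] H) {b b' : H}
    (hb : S.toContinuousLinearMap.adjoint b = 0) (hb' : S.toContinuousLinearMap.adjoint b' = 0)
    (n m : ℕ) :
    inner ℂ (S^[n] b) (S^[m] b') = if n = m then inner ℂ b b' else 0 := by
  rcases lt_trichotomy n m with h | rfl | h
  · rw [inner_isometry_iterate_of_lt S hb b' h, if_neg h.ne]
  · rw [if_pos rfl, inner_isometry_iterate_self]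
  · rw [← inner_conj_symm, inner_isometry_iterate_of_lt S hb' b h, if_neg h.ne', map_zero]

theorem orthonormal_isometry_iterate (S : H →ₗᵢ[ℂ] H) {ι : Type*} {b : ι → H}
    (hb : Orthonormal ℂ b) (hb0 : ∀ i, S.toContinuousLinearMap.adjoint (b i) = 0) :
    Orthonormal ℂ (fun p : ℕ × ι => S^[p.1] (b p.2)) := by
  classical
  rw [orthonormal_iff_ite] at hb ⊢
  rintro ⟨n, i⟩ ⟨m, j⟩
  rw [inner_isometry_iterate S (hb0 i) (hb0 j), hb]
  simp only [Prod.mk.injEq]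
  split_ifs <;> simp_all

/-- A vector which is orthogonal to all translates of the wandering subspace `ker S†` of an
isometry `S` belongs to the ranges of all powers of `S`. -/
theorem isometry_iterate_adjoint_iterate (S : H →ₗᵢ[ℂ] H) {ξ : H}
    (hξ : ∀ n, ∀ b, S.toContinuousLinearMap.adjoint b = 0 → inner ℂ (S^[n] b) ξ = 0) (n : ℕ) :
    S^[n] (S.toContinuousLinearMap.adjoint^[n] ξ) = ξ := by
  induction n with
  | zero => rfl
  | succ n ih =>
    set T := S.toContinuousLinearMap.adjoint with hT
    have hT' : ∀ η, T (S η) = η := adjoint_apply_isometry S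
    set η := T^[n] ξ
    -- `η - S (T η)` is the component of `η` in `ker S†`; it vanishes because it is orthogonal to
    -- both `η` and `S (T η)`.
    have hb0 : T (η - S (T η)) = 0 := by rw [map_sub, hT', sub_self]
    have h0 : inner ℂ (η - S (T η)) η = 0 := by
      have h := hξ n _ hb0
      rwa [← ih, inner_isometry_iterate_self] at h
    have h1 : inner ℂ (η - S (T η)) (S (T η)) = 0 := by
      change inner ℂ _ (S.toContinuousLinearMap _) = 0
      rw [← ContinuousLinearMap.adjoint_inner_left]
      change inner ℂ (T (η - S (T η))) (T η) = 0
      rw [hb0, inner_zero_left]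
    have h2 : η - S (T η) = 0 := by
      rw [← inner_self_eq_zero (𝕜 := ℂ), inner_sub_right, h0, h1, sub_zero]
    rw [Function.iterate_succ_apply' T, Function.iterate_succ_apply, ← sub_eq_zero.1 h2, ih]

end Wold

/-! ### A basis of the wandering subspace of the tree -/

/-- By Bessel's inequality only countably many members are nonzero at a given point, and each member
is nonzero somewhere. -/
theorem countable_of_orthonormal_ellTwo {V ι : Type*} [Countable V] {b : ι → EllTwo V}
    (hb : Orthonormal ℂ b) : Countable ι := by
  classical
  have h1 : ∀ u : V, {i | b i u ≠ 0}.Countable := by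
    intro u
    have h := (hb.inner_products_summable (lp.single 2 u (1 : ℂ))).countable_support
    refine h.mono fun i hi => ?_
    rw [Function.mem_support, lp.inner_single_right]
    simpa using hi
  rw [← Set.countable_univ_iff]
  refine (Set.countable_iUnion h1).mono fun i _ => ?_
  by_contra h
  simp only [Set.mem_iUnion, Set.mem_ofPred_eq, not_exists, not_not] at h
  exact hb.ne_zero i (lp.ext (funext h))

theorem linearIndependent_single_sub_single {α : Type*} [DecidableEq α] {i j : α} (hij : i ≠ j) :
    LinearIndependent ℂ (fun n : ℕ =>
      (lp.single 2 (i :: List.replicate n i) (1 : ℂ) -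
        lp.single 2 (j :: List.replicate n i) (1 : ℂ) : EllTwo (List α))) := by
  have hval : ∀ n m, (lp.single 2 (i :: List.replicate n i) (1 : ℂ) -
        lp.single 2 (j :: List.replicate n i) (1 : ℂ) : EllTwo (List α))
          (j :: List.replicate m i) = if n = m then -1 else 0 := by
    intro n m
    simp only [lp.coeFn_sub, Pi.sub_apply, lp.single_apply, Pi.single_apply]
    by_cases h : n = m
    · subst h; simp [hij.symm]
    · have h' : m ≠ n := Ne.symm h
      simp [hij.symm, h, h']
  rw [linearIndependent_iff']
  intro s g hg m hm
  -- Evaluation at the word `j i^m` isolates the coefficient of index `m`.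
  have h := congrArg (fun x : EllTwo (List α) => x (j :: List.replicate m i)) hg
  simp only [lp.coeFn_sum, Finset.sum_apply, lp.coeFn_smul, Pi.smul_apply, hval] at h
  simpa [hm] using h

theorem not_finiteDimensional_wandering (d : ℕ) [NeZero d] (hd : 2 ≤ d) :
    ¬ FiniteDimensional ℂ
      (LinearMap.ker (treeShift d).toContinuousLinearMap.adjoint.toLinearMap) := by
  intro hW
  have hij : (⟨0, by omega⟩ : Fin d) ≠ ⟨1, by omega⟩ := by simp
  have hli := linearIndependent_single_sub_single hij
  have hli' : LinearIndependent ℂ (fun n : ℕ =>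
      (⟨_, adjoint_treeShift_single_sub d ⟨0, by omega⟩ ⟨1, by omega⟩
        (List.replicate n ⟨0, by omega⟩)⟩ :
        LinearMap.ker (treeShift d).toContinuousLinearMap.adjoint.toLinearMap)) :=
    LinearIndependent.of_comp (Submodule.subtype _) hli
  have := hli'.finite
  exact not_finite ℕ

theorem exists_wandering_basis (d : ℕ) [NeZero d] (hd : 2 ≤ d) :
    ∃ b : ℕ → EllTwo (List (Fin d)), Orthonormal ℂ b ∧
      (∀ n, (treeShift d).toContinuousLinearMap.adjoint (b n) = 0) ∧
      ∀ ξ, (∀ n, inner ℂ (b n) ξ = 0) →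
        ∀ η, (treeShift d).toContinuousLinearMap.adjoint η = 0 → inner ℂ η ξ = 0 := by
  set T := (treeShift d).toContinuousLinearMap.adjoint with hT
  set W := LinearMap.ker T.toLinearMap with hW
  have hWc : CompleteSpace W := T.isClosed_ker.completeSpace_coe
  obtain ⟨w, b, hb⟩ := exists_hilbertBasis ℂ W
  have hbo : Orthonormal ℂ (fun i => (b i : EllTwo (List (Fin d)))) :=
    b.orthonormal.comp_linearIsometry W.subtypeₗᵢ
  have : Countable w := countable_of_orthonormal_ellTwo hbo
  have : Infinite w := by
    by_contra hfin
    rw [not_infinite_iff_finite] at hfin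
    have := Fintype.ofFinite w
    exact not_finiteDimensional_wandering d hd
      b.toOrthonormalBasis.toBasis.finiteDimensional_of_finite
  obtain ⟨e⟩ := nonempty_equiv_of_countable (α := ℕ) (β := w)
  refine ⟨fun n => b (e n), hbo.comp _ e.injective, fun n => (b (e n)).2, fun ξ h η hη => ?_⟩
  have h1 : ∀ i, inner ℂ (b i : EllTwo (List (Fin d))) ξ = 0 := fun i => by
    simpa using h (e.symm i)
  have h2 : (innerSL ℂ ξ).comp W.subtypeL = 0 := by
    refine ContinuousLinearMap.ext_on (s := Set.range b) ?_ ?_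
    · exact Submodule.dense_iff_topologicalClosure_eq_top.2 b.dense_span
    · rintro _ ⟨i, rfl⟩
      have := h1 i
      rw [← inner_conj_symm, map_eq_zero] at this
      simpa using this
  have h3 := DFunLike.congr_fun h2 (⟨η, hη⟩ : W)
  rw [← inner_conj_symm, map_eq_zero]
  simpa using h3

/-- The Wold decomposition of the shift isometry of the regular rooted tree. -/
theorem exists_tree_hilbertBasis (d : ℕ) [NeZero d] (hd : 2 ≤ d) :
    ∃ (b : ℕ → EllTwo (List (Fin d))) (B : HilbertBasis (ℕ × ℕ) ℂ (EllTwo (List (Fin d)))),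
      (∀ n, (treeShift d).toContinuousLinearMap.adjoint (b n) = 0) ∧
      ∀ p, B p = (treeShift d)^[p.1] (b p.2) := by
  obtain ⟨b, hb, hb0, hbt⟩ := exists_wandering_basis d hd
  have ho := orthonormal_isometry_iterate (treeShift d) hb hb0
  refine ⟨b, HilbertBasis.mkOfOrthogonalEqBot ho ?_, hb0, fun p => by
    rw [HilbertBasis.coe_mkOfOrthogonalEqBot]⟩
  rw [Submodule.eq_bot_iff]
  intro ξ hξ
  have h1 : ∀ n j, inner ℂ ((treeShift d)^[n] (b j)) ξ = 0 := fun n j =>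
    (Submodule.mem_orthogonal _ _).1 hξ _ (Submodule.subset_span ⟨(n, j), rfl⟩)
  have hadj : ∀ n (x y : EllTwo (List (Fin d))), inner ℂ ((treeShift d)^[n] x) y =
      inner ℂ x ((treeShift d).toContinuousLinearMap.adjoint^[n] y) := by
    intro n
    induction n with
    | zero => intro x y; rfl
    | succ n ih =>
      intro x y
      rw [Function.iterate_succ_apply, ih, Function.iterate_succ_apply',
        ContinuousLinearMap.adjoint_inner_right]
      rfl
  have h2 : ∀ n, ∀ η, (treeShift d).toContinuousLinearMap.adjoint η = 0 →
      inner ℂ ((treeShift d)^[n] η) ξ = 0 := by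
    intro n η hη
    rw [hadj]
    exact hbt _ (fun j => by rw [← hadj]; exact h1 n j) η hη
  ext u
  -- The power must exceed the length of `u` for the shifted vector to vanish at `u`.
  rw [← isometry_iterate_adjoint_iterate (treeShift d) h2 (u.length + 1)]
  exact treeShift_iterate_apply d _ _ u (Nat.lt_succ_self _)

/-! ### Rescaled Chebyshev polynomials of the second kind -/

open Polynomial in
/-- The Chebyshev polynomials of the second kind, rescaled to the interval `[-2c, 2c]`. -/
noncomputable def scaledU (c : ℝ) (n : ℕ) : ℝ[X] :=
  (Chebyshev.U ℝ (n : ℤ)).comp (C (1 / (2 * c)) * X)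

theorem scaledU_zero (c : ℝ) : scaledU c 0 = 1 := by
  simp [scaledU]

open Polynomial in
theorem X_mul_scaledU_zero {c : ℝ} (hc : c ≠ 0) : X * scaledU c 0 = C c * scaledU c 1 := by
  simp only [scaledU, Nat.cast_zero, Nat.cast_one, Chebyshev.U_zero, Chebyshev.U_one]
  rw [one_comp, mul_comp, X_comp, ← C_ofNat 2, C_comp, ← mul_assoc, ← mul_assoc, ← C_mul, ← C_mul]
  rw [show c * OfNat.ofNat 2 * (1 / (2 * c)) = 1 by field_simp]
  simp

open Polynomial in
theorem X_mul_scaledU_succ {c : ℝ} (hc : c ≠ 0) (n : ℕ) :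
    X * scaledU c (n + 1) = C c * scaledU c (n + 2) + C c * scaledU c n := by
  have h := congrArg (fun p => p.comp (C (1 / (2 * c)) * X)) (Chebyshev.U_add_two ℝ (n : ℤ))
  simp only [sub_comp, mul_comp, X_comp] at h
  simp only [scaledU, Nat.cast_add, Nat.cast_one, Nat.cast_ofNat]
  rw [h, ← C_ofNat 2, C_comp]
  have h2 : (C c * (C (OfNat.ofNat 2) * (C (1 / (2 * c)) * X)) : ℝ[X]) = X := by
    rw [← mul_assoc, ← mul_assoc, ← C_mul, ← C_mul,
      show c * OfNat.ofNat 2 * (1 / (2 * c)) = 1 by field_simp]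
    simp
  rw [mul_sub, ← mul_assoc, h2]
  ring

-- The span contains `1`, and the recurrence makes it stable under multiplication by `X`.
open Polynomial in
theorem span_range_scaledU {c : ℝ} (hc : c ≠ 0) :
    Submodule.span ℝ (Set.range (scaledU c)) = ⊤ := by
  set N := Submodule.span ℝ (Set.range (scaledU c)) with hN
  have hmem : ∀ n, scaledU c n ∈ N := fun n => Submodule.subset_span ⟨n, rfl⟩
  have hX : ∀ p ∈ N, X * p ∈ N := by
    intro p hp
    induction hp using Submodule.span_induction with
    | mem p hp =>
      obtain ⟨n, rfl⟩ := hp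
      cases n with
      | zero =>
        rw [X_mul_scaledU_zero hc, ← smul_eq_C_mul]
        exact N.smul_mem _ (hmem _)
      | succ n =>
        rw [X_mul_scaledU_succ hc, ← smul_eq_C_mul, ← smul_eq_C_mul]
        exact N.add_mem (N.smul_mem _ (hmem _)) (N.smul_mem _ (hmem _))
    | zero => rw [mul_zero]; exact N.zero_mem
    | add p q _ _ hp hq => rw [mul_add]; exact N.add_mem hp hq
    | smul a p _ hp => rw [mul_smul_comm]; exact N.smul_mem _ hp
  rw [eq_top_iff]
  rintro p -
  induction p using Polynomial.induction_on' with
  | add p q hp hq => exact N.add_mem hp hq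
  | monomial n a =>
    rw [← C_mul_X_pow_eq_monomial, ← smul_eq_C_mul]
    refine N.smul_mem _ ?_
    induction n with
    | zero => rw [pow_zero, ← scaledU_zero c]; exact hmem 0
    | succ n ih => rw [pow_succ']; exact hX _ ih

/-! ### The semicircle law -/

/-- Writing `(1 - x²) U_n = x T_{n+1} - T_{n+2}` reduces this to orthogonality of the polynomials
`T_k` for the weight `1/√(1 - x²)`. -/
theorem integral_sqrt_mul_U (n : ℕ) :
    ∫ x in (-1 : ℝ)..1, √(1 - x ^ 2) * (Polynomial.Chebyshev.U ℝ (n : ℤ)).eval x =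
      if n = 0 then Real.pi / 2 else 0 := by
  open Polynomial Polynomial.Chebyshev in
  have h1 : ∫ x in (-1 : ℝ)..1, √(1 - x ^ 2) * (U ℝ (n : ℤ)).eval x =
      ∫ x, (T ℝ (1 : ℕ)).eval x * (T ℝ ((n + 1 : ℕ) : ℤ)).eval x - (T ℝ (n + 2)).eval x
        ∂measureT := by
    rw [integral_measureT]
    refine intervalIntegral.integral_congr fun x hx => ?_
    rw [Set.uIcc_of_le (by norm_num)] at hx
    have hx' : 0 ≤ 1 - x ^ 2 := by nlinarith [hx.1, hx.2]
    have h := congrArg (eval x) (one_sub_X_sq_mul_U_eq_pol_in_T ℝ (n : ℤ))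
    simp only [eval_mul, eval_sub, eval_one, eval_pow, eval_X] at h
    simp only [Nat.cast_one, T_one, eval_X, Nat.cast_add]
    rw [← h, Real.sqrt_inv]
    rcases hx'.eq_or_lt with h0 | h0
    · simp [← h0]
    · have := Real.sqrt_pos.2 h0
      field_simp
      rw [Real.sq_sqrt hx']
  rw [h1, integral_sub (Polynomial.Chebyshev.integrable_measureT (by fun_prop))
    (Polynomial.Chebyshev.integrable_measureT (by fun_prop)),
    Polynomial.Chebyshev.integral_eval_T_real_measureT_of_ne_zero (by omega), sub_zero]
  split_ifs with hn
  · subst hn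
    exact Polynomial.Chebyshev.integral_T_real_mul_self_measureT_of_ne_zero one_ne_zero
  · exact Polynomial.Chebyshev.integral_eval_T_real_mul_eval_T_real_measureT_of_ne (by omega)

/-- The semicircle law on `[-2√d, 2√d]`. -/
noncomputable def semicircleMeasure (d : ℕ) : Measure ℝ :=
  (volume.restrict (Set.Icc (-(2 * √(d : ℝ))) (2 * √(d : ℝ)))).withDensity
    (fun x => ENNReal.ofReal (1 / (2 * Real.pi * d) * √(4 * d - x ^ 2)))

theorem integral_semicircleMeasure (d : ℕ) (f : ℝ → ℝ) :
    ∫ x, f x ∂semicircleMeasure d =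
      ∫ x in Set.Icc (-(2 * √(d : ℝ))) (2 * √(d : ℝ)),
        1 / (2 * Real.pi * d) * √(4 * d - x ^ 2) * f x := by
  rw [semicircleMeasure, integral_withDensity_eq_integral_toReal_smul (by fun_prop) (by simp)]
  refine integral_congr_ae (Filter.Eventually.of_forall fun x => ?_)
  simp only [smul_eq_mul]
  rw [ENNReal.toReal_ofReal (by positivity)]

instance isFiniteMeasure_semicircleMeasure (d : ℕ) : IsFiniteMeasure (semicircleMeasure d) := by
  refine isFiniteMeasure_withDensity_ofReal ?_
  refine Integrable.hasFiniteIntegral ?_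
  exact ContinuousOn.integrableOn_compact isCompact_Icc (by fun_prop)

theorem semicircleMeasure_compl (d : ℕ) :
    semicircleMeasure d (Set.Icc (-(2 * √(d : ℝ))) (2 * √(d : ℝ)))ᶜ = 0 := by
  refine (withDensity_absolutelyContinuous _ _) ?_
  rw [Measure.restrict_apply measurableSet_Icc.compl]
  simp

theorem integral_scaledU_semicircleMeasure (d : ℕ) [NeZero d] (n : ℕ) :
    ∫ x, (scaledU √(d : ℝ) n).eval x ∂semicircleMeasure d = if n = 0 then 1 else 0 := by
  have hd : (0 : ℝ) < d := by exact_mod_cast Nat.pos_of_ne_zero (NeZero.ne d)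
  have hs : 0 < √(d : ℝ) := Real.sqrt_pos.2 hd
  have hss : √(d : ℝ) ^ 2 = d := Real.sq_sqrt hd.le
  rw [integral_semicircleMeasure, integral_Icc_eq_integral_Ioc,
    ← intervalIntegral.integral_of_le (by linarith)]
  -- The substitution `x = 2√d y` brings the interval to `[-1, 1]`.
  have h := intervalIntegral.smul_integral_comp_mul_left (a := -1) (b := 1)
    (fun x => 1 / (2 * Real.pi * d) * √(4 * d - x ^ 2) * (scaledU √(d : ℝ) n).eval x)
    (2 * √(d : ℝ))
  rw [mul_one, mul_neg, mul_one] at h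
  rw [← h]
  have h2 : ∀ x : ℝ, 1 / (2 * Real.pi * d) * √(4 * d - (2 * √(d : ℝ) * x) ^ 2) *
      (scaledU √(d : ℝ) n).eval (2 * √(d : ℝ) * x) = (1 / (2 * Real.pi * d) * (2 * √(d : ℝ))) *
        (√(1 - x ^ 2) * (Polynomial.Chebyshev.U ℝ (n : ℤ)).eval x) := by
    intro x
    have h3 : 4 * (d : ℝ) - (2 * √(d : ℝ) * x) ^ 2 = (2 * √(d : ℝ)) ^ 2 * (1 - x ^ 2) := by
      rw [mul_pow, mul_pow, hss]; ring
    have h4 : (1 / (2 * √(d : ℝ))) * (2 * √(d : ℝ) * x) = x := by field_simp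
    rw [h3, Real.sqrt_mul (by positivity), Real.sqrt_sq (by positivity), scaledU]
    simp only [Polynomial.eval_comp, Polynomial.eval_mul, Polynomial.eval_C, Polynomial.eval_X, h4]
    ring
  simp_rw [h2]
  rw [intervalIntegral.integral_const_mul, integral_sqrt_mul_U, smul_eq_mul]
  split_ifs
  · have := Real.pi_pos
    field_simp
    rw [hss]
  · simp

/-! ### Moments of the Jacobi operator of an isometry -/

section Jacobi

variable {H : Type*} [NormedAddCommGroup H] [InnerProductSpace ℂ H] [CompleteSpace H]

theorem jacobi_apply_iterate_succ (S : H →ₗᵢ[ℂ] H) (b : H) (n : ℕ) :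
    (S.toContinuousLinearMap + S.toContinuousLinearMap.adjoint) (S^[n + 1] b) =
      S^[n + 2] b + S^[n] b := by
  rw [add_apply, Function.iterate_succ_apply' _ n, adjoint_apply_isometry,
    Function.iterate_succ_apply' _ (n + 1), Function.iterate_succ_apply' _ n]
  rfl

theorem jacobi_apply_zero (S : H →ₗᵢ[ℂ] H) {b : H} (hb : S.toContinuousLinearMap.adjoint b = 0) :
    (S.toContinuousLinearMap + S.toContinuousLinearMap.adjoint) b = S^[1] b := by
  rw [add_apply, hb, add_zero]
  rfl

/-- Both sequences start at `b` and obey the same three-term recurrence, in which the leading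
coefficient `c` is invertible. -/
theorem aeval_scaledU_apply (S : H →ₗᵢ[ℂ] H) {c : ℝ} (hc : c ≠ 0) {X : H →L[ℂ] H}
    (hX : X = (c : ℂ) • (S.toContinuousLinearMap + S.toContinuousLinearMap.adjoint))
    {b : H} (hb : S.toContinuousLinearMap.adjoint b = 0) (n : ℕ) :
    (Polynomial.aeval X (scaledU c n)) b = S^[n] b := by
  have hc' : (c : ℂ) ≠ 0 := by exact_mod_cast hc
  have key : ∀ p q : Polynomial ℝ, Polynomial.X * p = Polynomial.C c * q →
      X ((Polynomial.aeval X p) b) = (c : ℂ) • (Polynomial.aeval X q) b := by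
    intro p q h
    have := congrArg (fun r => (Polynomial.aeval X r) b) h
    simpa [Algebra.algebraMap_eq_smul_one] using this
  induction n using Nat.strong_induction_on with
  | _ n ih =>
    match n with
    | 0 => simp [scaledU_zero]
    | 1 =>
      have h := key _ _ (X_mul_scaledU_zero hc)
      rw [ih 0 (by norm_num), Function.iterate_zero_apply, hX, smul_apply,
        jacobi_apply_zero S hb, ← hX] at h
      exact (smul_right_injective H hc' h).symm
    | n + 2 =>
      have h := key (scaledU c (n + 1)) (scaledU c (n + 2) + scaledU c n)
        (by rw [X_mul_scaledU_succ hc, mul_add])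
      rw [ih (n + 1) (by omega), hX, smul_apply, jacobi_apply_iterate_succ, ← hX, map_add,
        add_apply, ih n (by omega)] at h
      exact (add_right_cancel (smul_right_injective H hc' h)).symm

theorem integrable_of_continuous_of_compl_null {ν : Measure ℝ} [IsFiniteMeasure ν] {K : Set ℝ}
    (hK : IsCompact K) (hν : ν Kᶜ = 0) {f : ℝ → ℝ} (hf : Continuous f) :
    Integrable f ν := by
  have h : ν = ν.restrict K := (Measure.restrict_eq_self_of_ae_mem (by
    rw [ae_iff]; exact hν)).symm
  rw [h]
  exact hf.continuousOn.integrableOn_compact hK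

/-- Both sides are linear in `p`, so it suffices to take `p = scaledU c n`, where the left side is
`⟨b, S^n b⟩`. -/
theorem inner_aeval_jacobi (S : H →ₗᵢ[ℂ] H) {c : ℝ} (hc : c ≠ 0) {X : H →L[ℂ] H}
    (hX : X = (c : ℂ) • (S.toContinuousLinearMap + S.toContinuousLinearMap.adjoint))
    {b : H} (hb : S.toContinuousLinearMap.adjoint b = 0) (hb1 : ‖b‖ = 1)
    {ν : Measure ℝ} [IsFiniteMeasure ν] {K : Set ℝ} (hK : IsCompact K) (hν : ν Kᶜ = 0)
    (hν1 : ∀ n, ∫ x, (scaledU c n).eval x ∂ν = if n = 0 then 1 else 0) (p : Polynomial ℝ) :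
    inner ℂ b ((Polynomial.aeval X p) b) = ((∫ x, p.eval x ∂ν : ℝ) : ℂ) := by
  have hp : p ∈ Submodule.span ℝ (Set.range (scaledU c)) := by
    rw [span_range_scaledU hc]; trivial
  have hint : ∀ q : Polynomial ℝ, Integrable (fun x => q.eval x) ν := fun q =>
    integrable_of_continuous_of_compl_null hK hν q.continuous
  induction hp using Submodule.span_induction with
  | mem p hp =>
    obtain ⟨n, rfl⟩ := hp
    rw [aeval_scaledU_apply S hc hX hb, hν1]
    have h := inner_isometry_iterate S hb hb 0 n
    rw [Function.iterate_zero_apply] at h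
    rw [h, inner_self_eq_norm_sq_to_K, hb1]
    rcases n with _ | n <;> simp
  | zero => simp
  | add p q _ _ hp hq =>
    simp only [map_add, add_apply, inner_add_right, Polynomial.eval_add]
    rw [hp, hq, integral_add (hint p) (hint q), Complex.ofReal_add]
  | smul a p _ hp =>
    simp only [map_smul, Polynomial.eval_smul, smul_eq_mul]
    rw [integral_const_mul, Complex.ofReal_mul, ← hp]
    change inner ℂ b (a • (Polynomial.aeval X p) b) = _
    rw [← Complex.coe_smul, inner_smul_right]

end Jacobi

/-! ### Identification of local spectral measures by their moments -/

section Moments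

variable {H : Type*} [NormedAddCommGroup H] [InnerProductSpace ℂ H] [CompleteSpace H]

/-- A polynomial within `ε` of `f` on `[a, b]` changes the left side by at most `ε ‖ξ‖²` and the
right side by at most `ε` times the mass of `ν`. -/
theorem re_inner_cfc_eq_integral {X : H →L[ℂ] H} (hX : IsSelfAdjoint X) (ξ : H) {ν : Measure ℝ}
    [IsFiniteMeasure ν] {a b : ℝ} (hν : ν (Set.Icc a b)ᶜ = 0)
    (hspec : spectrum ℝ X ⊆ Set.Icc a b)
    (hmom : ∀ p : Polynomial ℝ,
      (inner ℂ ξ ((Polynomial.aeval X p) ξ)).re = ∫ x, p.eval x ∂ν)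
    {f : ℝ → ℝ} (hf : Continuous f) :
    (inner ℂ ξ (cfc f X ξ)).re = ∫ x, f x ∂ν := by
  have hint : ∀ g : ℝ → ℝ, Continuous g → Integrable g ν := fun g hg =>
    integrable_of_continuous_of_compl_null isCompact_Icc hν hg
  have key : ∀ ε > 0, |(inner ℂ ξ (cfc f X ξ)).re - ∫ x, f x ∂ν| ≤
      ε * (‖ξ‖ ^ 2 + ν.real Set.univ) := by
    intro ε hε
    obtain ⟨p, hp⟩ := exists_polynomial_near_of_continuousOn a b f hf.continuousOn ε hε
    have h1 : ‖cfc f X - Polynomial.aeval X p‖ ≤ ε := by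
      rw [← cfc_polynomial p X, ← cfc_sub f p.eval X hf.continuousOn p.continuous.continuousOn]
      refine norm_cfc_le hε.le fun x hx => ?_
      rw [← norm_sub_rev]
      exact (hp x (hspec hx)).le
    have h2 : |(inner ℂ ξ (cfc f X ξ)).re - (inner ℂ ξ ((Polynomial.aeval X p) ξ)).re| ≤
        ε * ‖ξ‖ ^ 2 := by
      rw [← Complex.sub_re, ← inner_sub_right, ← sub_apply]
      calc |(inner ℂ ξ ((cfc f X - Polynomial.aeval X p) ξ)).re|
          ≤ ‖inner ℂ ξ ((cfc f X - Polynomial.aeval X p) ξ)‖ := Complex.abs_re_le_norm _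
        _ ≤ ‖ξ‖ * ‖(cfc f X - Polynomial.aeval X p) ξ‖ := norm_inner_le_norm _ _
        _ ≤ ‖ξ‖ * (ε * ‖ξ‖) := by
          gcongr
          exact ContinuousLinearMap.le_of_opNorm_le _ h1 ξ
        _ = ε * ‖ξ‖ ^ 2 := by ring
    have h3 : |(∫ x, p.eval x ∂ν) - ∫ x, f x ∂ν| ≤ ε * ν.real Set.univ := by
      rw [← integral_sub (hint _ p.continuous) (hint _ hf)]
      refine norm_integral_le_of_norm_le_const (μ := ν) (f := fun x => p.eval x - f x) ?_
      have : ∀ᵐ x ∂ν, x ∈ Set.Icc a b := hν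
      filter_upwards [this] with x hx
      exact (hp x hx).le
    rw [hmom p] at h2
    calc _ ≤ _ := abs_sub_le _ (∫ x, p.eval x ∂ν) _
      _ ≤ _ := add_le_add h2 h3
      _ = _ := by ring
  rw [← sub_eq_zero, ← abs_nonpos_iff]
  refine le_of_forall_pos_le_add fun ε hε => ?_
  have hC : 0 < ‖ξ‖ ^ 2 + ν.real Set.univ + 1 := by positivity
  refine (key (ε / (‖ξ‖ ^ 2 + ν.real Set.univ + 1)) (by positivity)).trans ?_
  rw [zero_add, div_mul_eq_mul_div, div_le_iff₀ hC]
  exact mul_le_mul_of_nonneg_left (by linarith) hε.le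

theorem localSpectralMeasure_eq_of_moments {X : H →L[ℂ] H} (hX : IsSelfAdjoint X) (ξ : H)
    {ν : Measure ℝ} [IsFiniteMeasure ν] {a b : ℝ} (hν : ν (Set.Icc a b)ᶜ = 0)
    (hspec : spectrum ℝ X ⊆ Set.Icc a b)
    (hmom : ∀ p : Polynomial ℝ,
      (inner ℂ ξ ((Polynomial.aeval X p) ξ)).re = ∫ x, p.eval x ∂ν) :
    localSpectralMeasure X ξ = ν := by
  have : (localSpectralMeasure X ξ).Regular := by
    unfold localSpectralMeasure; infer_instance
  refine Measure.ext_of_integral_eq_on_compactlySupported fun f => ?_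
  rw [integral_localSpectralMeasure]
  exact re_inner_cfc_eq_integral hX ξ hν hspec hmom f.continuous

end Moments

/-! ### Norm, spectrum and spectral measure of the free Jacobi operator -/

section Jacobi

variable {H : Type*} [NormedAddCommGroup H] [InnerProductSpace ℂ H] [CompleteSpace H]
  (d : ℕ) (S : H →ₗᵢ[ℂ] H) {X : H →L[ℂ] H}
  (hX : X = ((√(d : ℝ) : ℝ) : ℂ) • (S.toContinuousLinearMap + S.toContinuousLinearMap.adjoint))
  {b : H} (hb : S.toContinuousLinearMap.adjoint b = 0) (hb1 : ‖b‖ = 1)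

include hX

theorem isSelfAdjoint_jacobi : IsSelfAdjoint X := by
  rw [hX]
  refine IsSelfAdjoint.smul (Complex.conj_ofReal _) ?_
  exact IsSelfAdjoint.add_star_self S.toContinuousLinearMap

theorem norm_jacobi_le : ‖X‖ ≤ 2 * √(d : ℝ) := by
  have h : ‖S.toContinuousLinearMap‖ ≤ 1 := S.norm_toContinuousLinearMap_le
  rw [hX, norm_smul, Complex.norm_real, Real.norm_of_nonneg (by positivity), mul_comm]
  gcongr
  refine (norm_add_le _ _).trans ?_
  rw [LinearIsometryEquiv.norm_map]
  linarith

theorem spectrum_jacobi_subset :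
    spectrum ℝ X ⊆ Set.Icc (-(2 * √(d : ℝ))) (2 * √(d : ℝ)) := by
  intro x hx
  refine Set.mem_Icc.2 (abs_le.1 ?_)
  have : Nontrivial H := by
    by_contra h
    rw [not_nontrivial_iff_subsingleton] at h
    rw [spectrum.of_subsingleton] at hx
    exact hx
  exact (spectrum.norm_le_norm_of_mem hx).trans (norm_jacobi_le d S hX)

variable [NeZero d]

include hb hb1

theorem inner_aeval_eq_integral_semicircleMeasure (p : Polynomial ℝ) :
    inner ℂ b ((Polynomial.aeval X p) b) =
      ((∫ x, p.eval x ∂semicircleMeasure d : ℝ) : ℂ) :=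
  inner_aeval_jacobi S (by simp [NeZero.ne d]) hX hb hb1 isCompact_Icc
    (semicircleMeasure_compl d) (integral_scaledU_semicircleMeasure d) p

theorem localSpectralMeasure_jacobi : localSpectralMeasure X b = semicircleMeasure d :=
  localSpectralMeasure_eq_of_moments (isSelfAdjoint_jacobi d S hX) _
    (semicircleMeasure_compl d) (spectrum_jacobi_subset d S hX) fun p => by
      rw [inner_aeval_eq_integral_semicircleMeasure d S hX hb hb1, Complex.ofReal_re]

theorem Ioo_subset_spectrum_jacobi :
    Set.Ioo (-(2 * √(d : ℝ))) (2 * √(d : ℝ)) ⊆ spectrum ℝ X := by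
  intro t ht
  by_contra hts
  have hd : (0 : ℝ) < d := by exact_mod_cast Nat.pos_of_ne_zero (NeZero.ne d)
  obtain ⟨δ, hδ, hball⟩ := Metric.isOpen_iff.1
    (spectrum.isClosed (𝕜 := ℝ) X).isOpen_compl t hts
  -- A bump at `t` supported off the spectrum: its functional calculus is zero, yet its semicircle
  -- integral is positive.
  set f : ℝ → ℝ := fun x => max 0 (δ - dist x t) with hf
  have hfc : Continuous f := by fun_prop
  have h0 : cfc f X = 0 := by
    rw [← cfc_zero ℝ X]
    refine cfc_congr fun x hx => ?_
    have : ¬ dist x t < δ := fun h => hball (Metric.mem_ball.2 h) hx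
    exact max_eq_left (by linarith)
  have h1 := re_inner_cfc_eq_integral (isSelfAdjoint_jacobi d S hX) b
    (semicircleMeasure_compl d) (spectrum_jacobi_subset d S hX) (fun p => by
      rw [inner_aeval_eq_integral_semicircleMeasure d S hX hb hb1, Complex.ofReal_re]) hfc
  rw [h0, zero_apply, inner_zero_right, Complex.zero_re, integral_semicircleMeasure,
    integral_Icc_eq_integral_Ioc,
    ← intervalIntegral.integral_of_le (ht.1.trans ht.2).le] at h1
  refine h1.not_lt (intervalIntegral.integral_pos (ht.1.trans ht.2) (by fun_prop)
    (fun x _ => ?_) ⟨t, Set.Ioo_subset_Icc_self ht, ?_⟩)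
  · have : 0 ≤ f x := le_max_left _ _
    positivity
  · have h2 : 0 < f t := by simp [hf, hδ]
    have h3 : 0 < 4 * (d : ℝ) - t ^ 2 := by
      have : t ^ 2 < (2 * √(d : ℝ)) ^ 2 := sq_lt_sq' ht.1 ht.2
      rw [mul_pow, Real.sq_sqrt hd.le] at this
      linarith
    have := Real.sqrt_pos.2 h3
    positivity

theorem spectrum_real_jacobi :
    spectrum ℝ X = Set.Icc (-(2 * √(d : ℝ))) (2 * √(d : ℝ)) := by
  have hd : (0 : ℝ) < d := by exact_mod_cast Nat.pos_of_ne_zero (NeZero.ne d)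
  have hs : 0 < √(d : ℝ) := Real.sqrt_pos.2 hd
  refine (spectrum_jacobi_subset d S hX).antisymm ?_
  rw [← closure_Ioo (by linarith)]
  exact closure_minimal (Ioo_subset_spectrum_jacobi d S hX hb hb1) (spectrum.isClosed _)

theorem spectrum_jacobi :
    spectrum ℂ X = Complex.ofReal '' Set.Icc (-(2 * √(d : ℝ))) (2 * √(d : ℝ)) := by
  rw [← spectrum_real_jacobi d S hX hb hb1]
  exact ((isSelfAdjoint_jacobi d S hX).spectrumRestricts.algebraMap_image).symm

theorem norm_jacobi : ‖X‖ = 2 * √(d : ℝ) := by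
  refine (norm_jacobi_le d S hX).antisymm ?_
  have h : 2 * √(d : ℝ) ∈ spectrum ℝ X := by
    rw [spectrum_real_jacobi d S hX hb hb1]
    have := Real.sqrt_nonneg (d : ℝ)
    exact ⟨by linarith, le_rfl⟩
  have : Nontrivial H := ⟨b, 0, fun h => by simp [h] at hb1⟩
  exact (le_abs_self _).trans (spectrum.norm_le_norm_of_mem h)

end Jacobi

theorem norm_single_root (d : ℕ) :
    ‖(lp.single 2 ([] : List (Fin d)) (1 : ℂ) : EllTwo _)‖ = 1 := by
  rw [lp.norm_single (by norm_num)]; simp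

/-! ### Polynomials in vector-valued `L²` spaces -/

theorem coeFn_coordinateMul {K : Set ℝ} (hK : IsCompact K) (μ : Measure K)
    (ζ : Lp (EllTwo ℕ) 2 μ) :
    coordinateMul hK μ ζ =ᵐ[μ] fun x : K => ((x : ℝ) : ℂ) • ζ x :=
  (memLp_id_smul hK ζ).coeFn_toLp

section PolyTensor

variable {K : Set ℝ}

theorem exists_bound_polynomial_eval (hK : IsCompact K) (p : Polynomial ℝ) :
    ∃ C, ∀ x : K, ‖((p.eval (x : ℝ) : ℝ) : ℂ)‖ ≤ C := by
  obtain ⟨C, hC⟩ := hK.exists_bound_of_continuousOn p.continuous.continuousOn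
  exact ⟨C, fun x => by rw [Complex.norm_real]; exact hC x x.2⟩

theorem memLp_polyTensor (hK : IsCompact K) (μ : Measure K) [IsFiniteMeasure μ]
    (p : Polynomial ℝ) (v : EllTwo ℕ) :
    MemLp (fun x : K => ((p.eval (x : ℝ) : ℝ) : ℂ) • v) 2 μ := by
  obtain ⟨C, hC⟩ := exists_bound_polynomial_eval hK p
  refine MemLp.of_bound ?_ (C * ‖v‖) (Filter.Eventually.of_forall fun x => ?_)
  · have hc : Continuous fun x : K => ((p.eval (x : ℝ) : ℝ) : ℂ) • v :=
      (Complex.continuous_ofReal.comp (p.continuous.comp continuous_subtype_val)).smul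
        continuous_const
    exact hc.aestronglyMeasurable
  · rw [norm_smul]
    exact mul_le_mul_of_nonneg_right (hC x) (norm_nonneg v)

/-- The element `x ↦ p(x) v` of `L²(K, μ; ℓ²)`. -/
noncomputable def polyTensor (hK : IsCompact K) (μ : Measure K) [IsFiniteMeasure μ]
    (p : Polynomial ℝ) (v : EllTwo ℕ) : Lp (EllTwo ℕ) 2 μ :=
  (memLp_polyTensor hK μ p v).toLp _

variable (hK : IsCompact K) (μ : Measure K) [IsFiniteMeasure μ]

theorem coeFn_polyTensor (p : Polynomial ℝ) (v : EllTwo ℕ) :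
    polyTensor hK μ p v =ᵐ[μ] fun x : K => ((p.eval (x : ℝ) : ℝ) : ℂ) • v :=
  MemLp.coeFn_toLp _

theorem polyTensor_zero (v : EllTwo ℕ) : polyTensor hK μ 0 v = 0 := by
  ext1
  filter_upwards [coeFn_polyTensor hK μ 0 v, Lp.coeFn_zero (EllTwo ℕ) 2 μ] with x h1 h2
  rw [h1, h2]
  simp

theorem polyTensor_add (p q : Polynomial ℝ) (v : EllTwo ℕ) :
    polyTensor hK μ (p + q) v = polyTensor hK μ p v + polyTensor hK μ q v := by
  ext1
  filter_upwards [coeFn_polyTensor hK μ (p + q) v, coeFn_polyTensor hK μ p v,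
    coeFn_polyTensor hK μ q v, Lp.coeFn_add (polyTensor hK μ p v) (polyTensor hK μ q v)]
    with x h1 h2 h3 h4
  rw [h1, h4, Pi.add_apply, h2, h3, Polynomial.eval_add, Complex.ofReal_add, add_smul]

theorem polyTensor_smul (a : ℝ) (p : Polynomial ℝ) (v : EllTwo ℕ) :
    polyTensor hK μ (a • p) v = (a : ℂ) • polyTensor hK μ p v := by
  ext1
  filter_upwards [coeFn_polyTensor hK μ (a • p) v, coeFn_polyTensor hK μ p v,
    Lp.coeFn_smul (a : ℂ) (polyTensor hK μ p v)] with x h1 h2 h3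
  rw [h1, h3, Pi.smul_apply, h2, Polynomial.eval_smul, smul_eq_mul, Complex.ofReal_mul, mul_smul]

theorem coordinateMul_polyTensor (p : Polynomial ℝ) (v : EllTwo ℕ) :
    coordinateMul hK μ (polyTensor hK μ p v) = polyTensor hK μ (Polynomial.X * p) v := by
  ext1
  filter_upwards [coeFn_polyTensor hK μ (Polynomial.X * p) v, coeFn_polyTensor hK μ p v,
    coeFn_coordinateMul hK μ (polyTensor hK μ p v)] with x h1 h2 h3
  rw [h1, h3, h2, Polynomial.eval_mul, Polynomial.eval_X, Complex.ofReal_mul, mul_smul]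

theorem inner_polyTensor (p : Polynomial ℝ) (v : EllTwo ℕ) (ζ : Lp (EllTwo ℕ) 2 μ) :
    inner ℂ (polyTensor hK μ p v) ζ =
      ∫ x : K, ((p.eval (x : ℝ) : ℝ) : ℂ) * inner ℂ v (ζ x) ∂μ := by
  rw [L2.inner_def]
  refine integral_congr_ae ?_
  filter_upwards [coeFn_polyTensor hK μ p v] with x h
  rw [h, inner_smul_left, Complex.conj_ofReal]

theorem inner_polyTensor_polyTensor (p q : Polynomial ℝ) (v w : EllTwo ℕ) :
    inner ℂ (polyTensor hK μ p v) (polyTensor hK μ q w) =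
      ((∫ x : K, (p * q).eval (x : ℝ) ∂μ : ℝ) : ℂ) * inner ℂ v w := by
  rw [inner_polyTensor, ← integral_complex_ofReal, ← integral_mul_const]
  refine integral_congr_ae ?_
  filter_upwards [coeFn_polyTensor hK μ q w] with x h
  rw [h, inner_smul_right, Polynomial.eval_mul, Complex.ofReal_mul, mul_assoc]

-- Real polynomials are dense in `C(K, ℝ)` by Weierstrass, and `C(K, ℂ)` is dense in `L²`; real and
-- imaginary parts link the two.
include hK in
theorem Lp_eq_zero_of_forall_integral_polynomial (φ : Lp ℂ 2 μ)
    (h : ∀ p : Polynomial ℝ, ∫ x : K, ((p.eval (x : ℝ) : ℝ) : ℂ) * φ x ∂μ = 0) : φ = 0 := by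
  have : CompactSpace K := isCompact_iff_compactSpace.1 hK
  have hinner : ∀ f : C(K, ℂ), inner ℂ (ContinuousMap.toLp 2 μ ℂ f) φ =
      ∫ x : K, φ x * (starRingEnd ℂ) (f x) ∂μ := by
    intro f
    rw [L2.inner_def]
    refine integral_congr_ae ?_
    filter_upwards [ContinuousMap.coeFn_toLp (p := 2) (𝕜 := ℂ) μ f] with x hx
    rw [hx, RCLike.inner_apply]
  let ι : C(K, ℝ) → C(K, ℂ) := fun f => (⟨_, Complex.continuous_ofReal⟩ : C(ℝ, ℂ)).comp f
  have hι : Continuous ι := ContinuousMap.continuous_postcomp _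
  have hreal : ∀ f : C(K, ℝ), inner ℂ (ContinuousMap.toLp 2 μ ℂ (ι f)) φ = 0 := by
    have hclosed : IsClosed {f : C(K, ℝ) | inner ℂ (ContinuousMap.toLp 2 μ ℂ (ι f)) φ = 0} := by
      refine isClosed_eq ?_ continuous_const
      exact (((ContinuousMap.toLp 2 μ ℂ).continuous.comp hι).inner continuous_const)
    have hsub : (polynomialFunctions K : Set C(K, ℝ)) ⊆
        {f : C(K, ℝ) | inner ℂ (ContinuousMap.toLp 2 μ ℂ (ι f)) φ = 0} := by
      rw [polynomialFunctions_coe]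
      rintro _ ⟨p, rfl⟩
      change inner ℂ _ φ = 0
      rw [hinner, ← h p]
      refine integral_congr_ae (Filter.Eventually.of_forall fun x => ?_)
      simp [ι, mul_comm]
    intro f
    refine closure_minimal hsub hclosed ?_
    rw [← Subalgebra.topologicalClosure_coe, polynomialFunctions.topologicalClosure]
    trivial
  refine (ContinuousMap.toLp_denseRange (E := ℂ) (μ := μ) (𝕜 := ℂ) (p := 2)
    (by norm_num)).eq_zero_of_inner_right ℂ fun f => ?_
  have hf : f = ι ⟨fun x => (f x).re, by fun_prop⟩ +
      Complex.I • ι ⟨fun x => (f x).im, by fun_prop⟩ := by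
    ext x
    simp only [ι, ContinuousMap.add_apply, ContinuousMap.smul_apply, ContinuousMap.comp_apply,
      ContinuousMap.coe_mk, smul_eq_mul]
    rw [mul_comm, Complex.re_add_im]
  rw [hf, map_add, map_smul, inner_add_left, inner_smul_left, hreal, hreal]
  simp

/-- The standard basis vectors of `ℓ²(ℕ)`. -/
noncomputable def ellTwoBasis (j : ℕ) : EllTwo ℕ := lp.single 2 j (1 : ℂ)

theorem inner_ellTwoBasis (j : ℕ) (v : EllTwo ℕ) : inner ℂ (ellTwoBasis j) v = v j := by
  rw [ellTwoBasis, lp.inner_single_left]; simp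

/-- Each coordinate of `ζ` is orthogonal to all polynomials, hence null; countably many null sets
are then discarded together. -/
theorem eq_zero_of_forall_inner_polyTensor (ζ : Lp (EllTwo ℕ) 2 μ)
    (h : ∀ (p : Polynomial ℝ) j, inner ℂ (polyTensor hK μ p (ellTwoBasis j)) ζ = 0) : ζ = 0 := by
  have h1 : ∀ j, ∀ᵐ x ∂μ, ζ x j = 0 := by
    intro j
    have h2 := (innerSL ℂ (ellTwoBasis j)).coeFn_compLp ζ
    have h3 : (innerSL ℂ (ellTwoBasis j)).compLp ζ = 0 := by
      refine Lp_eq_zero_of_forall_integral_polynomial hK μ _ fun p => ?_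
      rw [← h p j, inner_polyTensor]
      refine integral_congr_ae ?_
      filter_upwards [h2] with x hx
      rw [hx, innerSL_apply_apply]
    rw [h3] at h2
    filter_upwards [h2, Lp.coeFn_zero ℂ 2 μ] with x hx hx0
    rw [hx0, innerSL_apply_apply, inner_ellTwoBasis] at hx
    exact hx.symm
  ext1
  filter_upwards [ae_all_iff.2 h1, Lp.coeFn_zero (EllTwo ℕ) 2 μ] with x hx hx0
  rw [hx0]
  exact lp.ext (funext hx)

theorem exists_polyTensor_hilbertBasis {c : ℝ} (hc : c ≠ 0)
    (horth : ∀ n m, ∫ x : K, (scaledU c n * scaledU c m).eval (x : ℝ) ∂μ =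
      if n = m then 1 else 0) :
    ∃ B : HilbertBasis (ℕ × ℕ) ℂ (Lp (EllTwo ℕ) 2 μ),
      ∀ p, B p = polyTensor hK μ (scaledU c p.1) (ellTwoBasis p.2) := by
  have ho : Orthonormal ℂ (fun p : ℕ × ℕ =>
      polyTensor hK μ (scaledU c p.1) (ellTwoBasis p.2)) := by
    rw [orthonormal_iff_ite]
    rintro ⟨n, i⟩ ⟨m, j⟩
    rw [inner_polyTensor_polyTensor, horth, inner_ellTwoBasis, ellTwoBasis]
    by_cases hn : n = m <;> by_cases hi : i = j <;>
      simp [hn, hi, lp.single_apply]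
  refine ⟨HilbertBasis.mkOfOrthogonalEqBot ho ?_, fun p => by
    rw [HilbertBasis.coe_mkOfOrthogonalEqBot]⟩
  rw [Submodule.eq_bot_iff]
  intro ζ hζ
  refine eq_zero_of_forall_inner_polyTensor hK μ ζ fun p j => ?_
  have hp : p ∈ Submodule.span ℝ (Set.range (scaledU c)) := by
    rw [span_range_scaledU hc]; trivial
  induction hp using Submodule.span_induction with
  | mem p hp =>
    obtain ⟨n, rfl⟩ := hp
    exact (Submodule.mem_orthogonal _ _).1 hζ _ (Submodule.subset_span ⟨(n, j), rfl⟩)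
  | zero => rw [polyTensor_zero, inner_zero_left]
  | add p q _ _ hp hq => rw [polyTensor_add, inner_add_left, hp, hq, add_zero]
  | smul a p _ hp => rw [polyTensor_smul, inner_smul_left, hp, mul_zero]

theorem multiplicityL2_top {ν : Measure K} : multiplicityL2 ν (fun _ => ⊤) = ⊤ := by
  rw [eq_top_iff]
  intro ζ _
  change ∀ᵐ x ∂ν, ∀ j : ℕ, (⊤ : ℕ∞) ≤ (j : ℕ∞) → ζ x j = 0
  refine Filter.Eventually.of_forall fun x j hj => ?_
  exact absurd (top_le_iff.1 hj) (ENat.natCast_ne_top j)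

end PolyTensor

/-! ### The spectral representation of the free Jacobi operator -/

section Representation

theorem isFiniteMeasure_comap_subtype (ν : Measure ℝ) [IsFiniteMeasure ν] {K : Set ℝ}
    (hK : MeasurableSet K) : IsFiniteMeasure (ν.comap (Subtype.val : K → ℝ)) := by
  constructor
  rw [comap_subtype_coe_apply hK]
  exact measure_lt_top _ _

theorem integral_comap_subtype (ν : Measure ℝ) {K : Set ℝ} (hK : MeasurableSet K)
    (hν : ν Kᶜ = 0) (f : ℝ → ℝ) :
    ∫ x : K, f x ∂(ν.comap (Subtype.val : K → ℝ)) = ∫ x, f x ∂ν := by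
  rw [integral_subtype_comap hK, Measure.restrict_eq_self_of_ae_mem]
  rw [ae_iff]
  exact hν

variable {H : Type*} [NormedAddCommGroup H] [InnerProductSpace ℂ H] {X : H →L[ℂ] H}

/-- Unitary equivalence with multiplication by the coordinate determines polynomials of the
operator. -/
theorem coeFn_isometryEquiv_aeval {K : Set ℝ} (hK : IsCompact K) (μ : Measure K)
    (U : H ≃ₗᵢ[ℂ] Lp (EllTwo ℕ) 2 μ) (hU : ∀ ξ, U (X ξ) = coordinateMul hK μ (U ξ))
    (p : Polynomial ℝ) (η : H) :
    U ((Polynomial.aeval X p) η) =ᵐ[μ] fun x : K => ((p.eval (x : ℝ) : ℝ) : ℂ) • U η x := by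
  induction p using Polynomial.induction_on' with
  | add p q hp hq =>
    rw [map_add, add_apply, map_add]
    filter_upwards [hp, hq, Lp.coeFn_add (U ((Polynomial.aeval X p) η))
      (U ((Polynomial.aeval X q) η))] with x h1 h2 h3
    rw [h3, Pi.add_apply, h1, h2, Polynomial.eval_add, Complex.ofReal_add, add_smul]
  | monomial n a =>
    have hpow : U ((X ^ n) η) =ᵐ[μ] fun x : K => (((x : ℝ) ^ n : ℝ) : ℂ) • U η x := by
      induction n with
      | zero => exact Filter.Eventually.of_forall fun x => by simp
      | succ n ih =>
        rw [pow_succ', mul_apply_eq_comp, hU]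
        filter_upwards [ih, coeFn_coordinateMul hK μ (U ((X ^ n) η))] with x h1 h2
        rw [h2, h1, pow_succ', Complex.ofReal_mul, mul_smul]
    have hm : (Polynomial.aeval X (Polynomial.monomial n a)) η = (a : ℂ) • (X ^ n) η := by
      rw [← Polynomial.smul_X_eq_monomial, map_smul, map_pow, Polynomial.aeval_X]
      rfl
    rw [hm, map_smul]
    filter_upwards [hpow, Lp.coeFn_smul (a : ℂ) (U ((X ^ n) η))] with x h1 h2
    rw [h2, Pi.smul_apply, h1, Polynomial.eval_monomial, Complex.ofReal_mul, mul_smul]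

theorem unitarilyEquivalent_straightMul_top {K : Set ℝ} (hK : IsCompact K) (μ : Measure K)
    (U : H ≃ₗᵢ[ℂ] Lp (EllTwo ℕ) 2 μ) (hU : ∀ ξ, U (X ξ) = coordinateMul hK μ (U ξ)) :
    UnitarilyEquivalent X (straightMul hK μ fun _ => ⊤) := by
  refine ⟨U.trans (LinearIsometryEquiv.ofTop (Lp (EllTwo ℕ) 2 μ) _ multiplicityL2_top).symm,
    fun ξ => Subtype.ext ?_⟩
  exact hU ξ

variable [CompleteSpace H]
  (S : H →ₗᵢ[ℂ] H) {c : ℝ} (hc : c ≠ 0)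
  (hX : X = (c : ℂ) • (S.toContinuousLinearMap + S.toContinuousLinearMap.adjoint))
  {b : ℕ → H} (hb : ∀ j, S.toContinuousLinearMap.adjoint (b j) = 0)
  {B : HilbertBasis (ℕ × ℕ) ℂ H} (hB : ∀ p, B p = S^[p.1] (b p.2))

-- The unitary matches the two Hilbert bases. It sends `p(X) (b j)` to `p ⊗ e_j` for every
-- polynomial `p`, so applying `X` becomes replacing `p` by `X p`.
include hc hX hb hB in
theorem exists_isometryEquiv_coordinateMul {K : Set ℝ} (hK : IsCompact K) (μ : Measure K)
    [IsFiniteMeasure μ]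
    (horth : ∀ n m, ∫ x : K, (scaledU c n * scaledU c m).eval (x : ℝ) ∂μ =
      if n = m then 1 else 0) :
    ∃ U : H ≃ₗᵢ[ℂ] Lp (EllTwo ℕ) 2 μ, ∀ ξ, U (X ξ) = coordinateMul hK μ (U ξ) := by
  classical
  obtain ⟨B', hB'⟩ := exists_polyTensor_hilbertBasis hK μ hc horth
  set U : H ≃ₗᵢ[ℂ] Lp (EllTwo ℕ) 2 μ := B.repr.trans B'.repr.symm with hU
  have hUB : ∀ p, U (B p) = B' p := by
    intro p
    rw [hU, LinearIsometryEquiv.trans_apply, B.repr_self, B'.repr_symm_single]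
  have hpoly : ∀ (p : Polynomial ℝ) j,
      U ((Polynomial.aeval X p) (b j)) = polyTensor hK μ p (ellTwoBasis j) := by
    intro p j
    have hp : p ∈ Submodule.span ℝ (Set.range (scaledU c)) := by
      rw [span_range_scaledU hc]; trivial
    induction hp using Submodule.span_induction with
    | mem p hp =>
      obtain ⟨n, rfl⟩ := hp
      rw [aeval_scaledU_apply S hc hX (hb j), ← hB (n, j), hUB, hB']
    | zero => rw [polyTensor_zero, map_zero, zero_apply, map_zero]
    | add p q _ _ hp hq => rw [polyTensor_add, map_add, add_apply, map_add, hp, hq]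
    | smul a p _ hp =>
      have h : (Polynomial.aeval X (a • p)) (b j) = (a : ℂ) • (Polynomial.aeval X p) (b j) := by
        rw [map_smul]; rfl
      rw [polyTensor_smul, ← hp, h, map_smul]
  refine ⟨U, fun ξ => ?_⟩
  have hdense : Dense (Submodule.span ℂ (Set.range B) : Set H) :=
    Submodule.dense_iff_topologicalClosure_eq_top.2 B.dense_span
  have h : (U : H →L[ℂ] Lp (EllTwo ℕ) 2 μ).comp X =
      (coordinateMul hK μ).comp (U : H →L[ℂ] Lp (EllTwo ℕ) 2 μ) := by
    refine ContinuousLinearMap.ext_on hdense ?_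
    rintro _ ⟨⟨n, j⟩, rfl⟩
    change U (X (B (n, j))) = coordinateMul hK μ (U (B (n, j)))
    rw [hUB, hB', hB, ← aeval_scaledU_apply S hc hX (hb j), coordinateMul_polyTensor, ← hpoly,
      map_mul, Polynomial.aeval_X]
    rfl
  exact DFunLike.congr_fun h ξ

/-- Transported by `U`, the moments of `X` at `η` are `∫ p(x) ‖(U η)(x)‖² dμ`. -/
theorem localSpectralMeasure_eq_map (hXs : IsSelfAdjoint X) {K : Set ℝ} (hK : IsCompact K)
    {u v : ℝ} (hKuv : K = Set.Icc u v) (hspec : spectrum ℝ X ⊆ K) (μ : Measure K)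
    (U : H ≃ₗᵢ[ℂ] Lp (EllTwo ℕ) 2 μ) (hU : ∀ ξ, U (X ξ) = coordinateMul hK μ (U ξ)) (η : H) :
    localSpectralMeasure X η =
      (μ.withDensity fun x => ENNReal.ofReal (‖U η x‖ ^ 2)).map Subtype.val := by
  subst hKuv
  have hint : Integrable (fun x => ‖U η x‖ ^ 2) μ :=
    (Lp.memLp (U η)).integrable_norm_pow (by norm_num)
  have hfin : IsFiniteMeasure (μ.withDensity fun x => ENNReal.ofReal (‖U η x‖ ^ 2)) :=
    isFiniteMeasure_withDensity_ofReal hint.hasFiniteIntegral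
  refine localSpectralMeasure_eq_of_moments hXs η (a := u) (b := v) ?_ hspec fun p => ?_
  · rw [Measure.map_apply measurable_subtype_coe measurableSet_Icc.compl]
    convert measure_empty (μ := μ.withDensity fun x => ENNReal.ofReal (‖U η x‖ ^ 2))
    ext x
    simp
  · rw [integral_map measurable_subtype_coe.aemeasurable p.continuous.aestronglyMeasurable,
      integral_withDensity_eq_integral_toReal_smul₀ hint.aemeasurable.ennreal_ofReal (by simp),
      ← U.inner_map_map, L2.inner_def]
    rw [← Complex.ofReal_re (∫ x, _ ∂μ), ← integral_complex_ofReal]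
    congr 1
    refine integral_congr_ae ?_
    filter_upwards [coeFn_isometryEquiv_aeval hK μ U hU p η] with x hx
    rw [hx, inner_smul_right, inner_self_eq_norm_sq_to_K, ENNReal.toReal_ofReal (by positivity)]
    simp [mul_comm]

end Representation

/-! ### The adjacency operator of the tree -/

section Jacobi

variable {H : Type*} [NormedAddCommGroup H] [InnerProductSpace ℂ H] [CompleteSpace H]
  (d : ℕ) [NeZero d] (S : H →ₗᵢ[ℂ] H) {X : H →L[ℂ] H}
  (hX : X = ((√(d : ℝ) : ℝ) : ℂ) • (S.toContinuousLinearMap + S.toContinuousLinearMap.adjoint))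
  {b : ℕ → H} (hb : ∀ j, S.toContinuousLinearMap.adjoint (b j) = 0)
  {B : HilbertBasis (ℕ × ℕ) ℂ H} (hB : ∀ p, B p = S^[p.1] (b p.2))

-- Orthogonality is read off the operator: `⟨U_n(X) e, U_m(X) e⟩ = ⟨S^n e, S^m e⟩`, with `U_n(X)`
-- self-adjoint.
include hX in
theorem integral_scaledU_mul_scaledU {e : H} (he : S.toContinuousLinearMap.adjoint e = 0)
    (he1 : ‖e‖ = 1) (n m : ℕ) :
    ∫ x, (scaledU √(d : ℝ) n * scaledU √(d : ℝ) m).eval x ∂semicircleMeasure d =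
      if n = m then 1 else 0 := by
  have hc : √(d : ℝ) ≠ 0 := by simp [NeZero.ne d]
  have h := inner_aeval_eq_integral_semicircleMeasure d S hX he he1
    (scaledU √(d : ℝ) n * scaledU √(d : ℝ) m)
  have hsa : IsSelfAdjoint (Polynomial.aeval X (scaledU √(d : ℝ) n)) := by
    rw [← cfc_polynomial (scaledU √(d : ℝ) n) X (isSelfAdjoint_jacobi d S hX)]
    exact cfc_predicate _ _
  rw [map_mul, mul_apply_eq_comp, ← hsa.adjoint_eq,
    ContinuousLinearMap.adjoint_inner_right, aeval_scaledU_apply S hc hX he,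
    aeval_scaledU_apply S hc hX he, inner_isometry_iterate S he he, inner_self_eq_norm_sq_to_K,
    he1] at h
  rw [← Complex.ofReal_inj, ← h]
  split_ifs <;> simp

-- `K` is a variable equal to the interval, so that it can be taken to be either the interval itself
-- or the spectrum of `X`, whose subtypes are different types.
include hX hb hB in
theorem exists_isometryEquiv_semicircleMeasure {K : Set ℝ} (hK : IsCompact K)
    (hKd : K = Set.Icc (-(2 * √(d : ℝ))) (2 * √(d : ℝ))) :
    ∃ U : H ≃ₗᵢ[ℂ] Lp (EllTwo ℕ) 2 ((semicircleMeasure d).comap (Subtype.val : K → ℝ)),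
      ∀ ξ, U (X ξ) = coordinateMul hK _ (U ξ) := by
  have hc : √(d : ℝ) ≠ 0 := by simp [NeZero.ne d]
  have := isFiniteMeasure_comap_subtype (semicircleMeasure d) hK.measurableSet
  refine exists_isometryEquiv_coordinateMul S hc hX hb hB hK _ fun n m => ?_
  have h0 : S^[0] (b 0) = B (0, 0) := (hB (0, 0)).symm
  rw [integral_comap_subtype (semicircleMeasure d) hK.measurableSet
    (hKd ▸ semicircleMeasure_compl d)
    fun x => (scaledU √(d : ℝ) n * scaledU √(d : ℝ) m).eval x]
  refine integral_scaledU_mul_scaledU d S hX (hb 0) ?_ n m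
  rw [← Function.iterate_zero_apply S (b 0), h0]
  exact B.orthonormal.1 (0, 0)

include hX hb hB in
theorem isDominantVector_jacobi {e : H} (he : S.toContinuousLinearMap.adjoint e = 0)
    (he1 : ‖e‖ = 1) : IsDominantVector X e := by
  intro η
  obtain ⟨U, hU⟩ := exists_isometryEquiv_semicircleMeasure d S hX hb hB isCompact_Icc rfl
  rw [localSpectralMeasure_jacobi d S hX he he1, localSpectralMeasure_eq_map
    (isSelfAdjoint_jacobi d S hX) isCompact_Icc rfl (spectrum_jacobi_subset d S hX) _ U hU η]
  -- The measure at `η` has density `‖U η‖²` with respect to the semicircle law on the interval.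
  refine ((withDensity_absolutelyContinuous _ _).map measurable_subtype_coe).trans ?_
  rw [map_comap_subtype_coe measurableSet_Icc]
  exact Measure.absolutelyContinuous_of_le Measure.restrict_le_self

include hX hb hB in
theorem hasUniformMultiplicity_jacobi : HasUniformMultiplicity X ⊤ := by
  have he1 : ‖b 0‖ = 1 := by
    rw [← Function.iterate_zero_apply S (b 0), ← hB (0, 0)]
    exact B.orthonormal.1 (0, 0)
  obtain ⟨U, hU⟩ := exists_isometryEquiv_semicircleMeasure d S hX hb hB
    (spectrum.isCompact (𝕜 := ℝ) X) (spectrum_real_jacobi d S hX (hb 0) he1)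
  exact ⟨semicircleMeasure d, fun _ => ⊤,
    ⟨⟨b 0, isDominantVector_jacobi d S hX hb hB (hb 0) he1,
      (localSpectralMeasure_jacobi d S hX (hb 0) he1).symm⟩, measurable_const,
      fun _ => le_top, unitarilyEquivalent_straightMul_top _ _ U hU⟩,
    Filter.Eventually.of_forall fun _ => rfl⟩

end Jacobi

theorem mainTheorem4 (d : ℕ) (hd : 2 ≤ d) :
    ‖rootedTreeOperator d‖ = 2 * √(d : ℝ) ∧
    spectrum ℂ (rootedTreeOperator d) =
      Complex.ofReal '' Set.Icc (-(2 * √(d : ℝ))) (2 * √(d : ℝ)) ∧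
    localSpectralMeasure (rootedTreeOperator d) (lp.single 2 ([] : List (Fin d)) (1 : ℂ)) =
      (volume.restrict (Set.Icc (-(2 * √(d : ℝ))) (2 * √(d : ℝ)))).withDensity
        (fun x => ENNReal.ofReal (1 / (2 * Real.pi * d) * √(4 * d - x ^ 2))) ∧
    IsScalarSpectralMeasure (rootedTreeOperator d)
      ((volume.restrict (Set.Icc (-(2 * √(d : ℝ))) (2 * √(d : ℝ)))).withDensity
        (fun x => ENNReal.ofReal (1 / (2 * Real.pi * d) * √(4 * d - x ^ 2)))) ∧
    HasUniformMultiplicity (rootedTreeOperator d) ⊤ := by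
  have : NeZero d := ⟨by omega⟩
  have hX := rootedTreeOperator_eq d
  have he := adjoint_treeShift_single_nil d
  have he1 := norm_single_root d
  obtain ⟨b, B, hb, hB⟩ := exists_tree_hilbertBasis d hd
  have hμ := localSpectralMeasure_jacobi d _ hX he he1
  exact ⟨norm_jacobi d _ hX he he1, spectrum_jacobi d _ hX he he1, hμ,
    ⟨_, isDominantVector_jacobi d _ hX hb hB he he1, hμ.symm⟩,
    hasUniformMultiplicity_jacobi d _ hX hb hB⟩
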